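/- Let $n\ge 1$, $m\ge 0$ and $c_1\ge c_2\ge 0$ be integers with $2c_2-c_1>2n-2$. Definitions. Let $V$ be a set of group words. For a group $F$ let $V(F)$ be its verbal subgroup. For a normal subgroup $R$ of $F$ let $[RV^*F]$ be the subgroup generated by all $v(f_1,\dots,f_ir,\dots,f_s)\,v(f_1,\dots,f_i,\dots,f_s)^{-1}$ with $v\in V$, $r\in R$, $f_j\in F$, $1\le i\le s$. The Baer invariant of a group $G\cong F/R$, with $F$ free, is $\mathcal VM(G)=(R\cap V(F))/[RV^*F]$. For $c\ge 1$ let $\gamma_c$ be the left-normed commutator word $[x_1,\dots,x_c]$, and let $\mathcal V$ be the variety defined by the single word $[\gamma_{c_1+1},\gamma_{c_2+1}]$, in which the two inner commutators are written in disjoint sets of variables. The $n$th nilpotent product $\mathbf Z\stackrel{n}{*}\cdots\stackrel{n}{*}\mathbf Z$ of $m$ copies of the infinite cyclic group is $P/(\gamma_{n+1}(P)\cap C)$, where $P$ is the free product of the $m$ copies and $C$ is the normal closure in $P$ of all commutators of elements of two different free factors; this is the free nilpotent group of class $n$ and rank $m$. For $i\ge1$ put $\chi_i(d)=\frac1i\sum_{k\mid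 i}\mu(k)\,d^{\,i/k}$, where $\mu$ is the Möbius function. Statement. For $G=\mathbf Z\stackrel{n}{*}\cdots\stackrel{n}{*}\mathbf Z$ ($m$ copies), and for every free presentation $G\cong F/R$, the following hold. (i) If $c_2+n<c_1+1$, then $\mathcal VM(G)\cong\mathbf Z^{k}$, where $$k=\Big(\sum_{i=c_1+1}^{c_1+n}\chi_i(m)\Big)\Big(\sum_{i=c_2+1}^{c_2+n}\chi_i(m)\Big).$$ (ii) If $c_2+n\ge c_1+1$, then $\mathcal VM(G)\cong\mathbf Z^{k'}$, where $$k'=\Big(\sum_{i=c_1+1}^{c_1+n}\chi_i(m)\Big)\Big(\sum_{i=c_2+1}^{c_1}\chi_i(m)\Big)+\chi_2\Big(\sum_{i=c_1+1}^{c_2+n}\chi_i(m)\Big).$$ (An empty sum is $0$.) -/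

import Mathlib

open scoped commutatorElement

/-- The value `v(f₀, f₁, f₂, …)` of the word `v` in the variables `x₀, x₁, x₂, …`
at the elements `f₀, f₁, f₂, …` of a group `G`. -/
def wordValue {G : Type*} [Group G] (v : FreeGroup ℕ) (f : ℕ → G) : G :=
  FreeGroup.lift f v

/-- The left-normed commutator word `[x_s, x_{s+1}, …, x_{s+c}]` of weight `c + 1`,
i.e. the word `γ_{c+1}` written in the variables `x_s, …, x_{s+c}`. -/
def gammaWord (s : ℕ) : ℕ → FreeGroup ℕ
  | 0 => FreeGroup.of s
  | c + 1 => ⁅gammaWord s c, FreeGroup.of (s + (c + 1))⁆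

/-- The outer commutator word `[γ_{c₁+1}, γ_{c₂+1}]`, where the two left-normed commutators are
written in disjoint sets of variables:
`[[x₀, …, x_{c₁}], [x_{c₁+1}, …, x_{c₁+c₂+1}]]`. -/
def outerCommutatorWord (c₁ c₂ : ℕ) : FreeGroup ℕ :=
  ⁅gammaWord 0 c₁, gammaWord (c₁ + 1) c₂⁆

/-- The verbal subgroup `V(G)` of `G` for the set of words `V`. -/
def verbalSubgroup (V : Set (FreeGroup ℕ)) (G : Type*) [Group G] : Subgroup G :=
  Subgroup.closure {g | ∃ v ∈ V, ∃ f : ℕ → G, g = wordValue v f}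

/-- The subgroup `[R V* F]` generated by the elements
`v(f₁, …, fᵢ r, …, fₖ) v(f₁, …, fᵢ, …, fₖ)⁻¹` with `v ∈ V`, `r ∈ R`, `fⱼ ∈ F`. -/
def starSubgroup (V : Set (FreeGroup ℕ)) {F : Type*} [Group F] (R : Subgroup F) : Subgroup F :=
  Subgroup.closure {g | ∃ v ∈ V, ∃ f : ℕ → F, ∃ i : ℕ, ∃ r ∈ R,
    g = wordValue v (Function.update f i (f i * r)) * (wordValue v f)⁻¹}

theorem map_wordValue {G H : Type*} [Group G] [Group H] (φ : G →* H) (v : FreeGroup ℕ)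
    (f : ℕ → G) : φ (wordValue v f) = wordValue v (fun j => φ (f j)) := by
  have h : φ.comp (FreeGroup.lift f) = FreeGroup.lift (fun j => φ (f j)) := by
    ext j
    simp
  exact DFunLike.congr_fun h v

theorem normal_closure_of_conj {G : Type*} [Group G] (S : Set G)
    (h : ∀ s ∈ S, ∀ g : G, g * s * g⁻¹ ∈ S) : (Subgroup.closure S).Normal := by
  have : Subgroup.normalClosure S = Subgroup.closure S := by
    apply le_antisymm _ Subgroup.closure_le_normalClosure
    rw [Subgroup.normalClosure]
    refine (Subgroup.closure_le _).2 fun x hx => ?_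
    obtain ⟨a, ha, hx⟩ := Group.mem_conjugatesOfSet_iff.1 hx
    obtain ⟨c, rfl⟩ := isConj_iff.1 hx
    exact Subgroup.subset_closure (h a ha c)
  rw [← this]
  exact Subgroup.normalClosure_normal

instance verbalSubgroup_normal (V : Set (FreeGroup ℕ)) (G : Type*) [Group G] :
    (verbalSubgroup V G).Normal := by
  refine normal_closure_of_conj _ ?_
  rintro _ ⟨v, hv, f, rfl⟩ g
  refine ⟨v, hv, fun j => g * f j * g⁻¹, ?_⟩
  simpa using map_wordValue (MulAut.conj g).toMonoidHom v f

instance starSubgroup_normal (V : Set (FreeGroup ℕ)) {F : Type*} [Group F] (R : Subgroup F)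
    [hR : R.Normal] : (starSubgroup V R).Normal := by
  refine normal_closure_of_conj _ ?_
  rintro _ ⟨v, hv, f, i, r, hr, rfl⟩ g
  refine ⟨v, hv, fun j => g * f j * g⁻¹, i, g * r * g⁻¹, hR.conj_mem r hr g, ?_⟩
  have h1 := map_wordValue (MulAut.conj g).toMonoidHom v f
  have h2 := map_wordValue (MulAut.conj g).toMonoidHom v (Function.update f i (f i * r))
  have h3 : (fun j => g * Function.update f i (f i * r) j * g⁻¹) =
      Function.update (fun j => g * f j * g⁻¹) i (g * f i * g⁻¹ * (g * r * g⁻¹)) := by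
    funext j
    by_cases hj : j = i
    · subst hj
      simp [mul_assoc]
    · simp [hj]
  simp only [MulEquiv.toMonoidHom_eq_coe, MonoidHom.coe_coe, MulAut.conj_apply] at h1 h2
  rw [h3] at h2
  rw [← h1, ← h2]
  group

/-- `[R V* F]` lies in `R ∩ V(F)`, so that the quotient below is the intended one. -/
theorem starSubgroup_le (V : Set (FreeGroup ℕ)) {F : Type*} [Group F] (R : Subgroup F)
    [hR : R.Normal] : starSubgroup V R ≤ R ⊓ verbalSubgroup V F := by
  refine (Subgroup.closure_le _).2 ?_
  rintro _ ⟨v, hv, f, i, r, hr, rfl⟩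
  refine Subgroup.mem_inf.2 ⟨?_, (verbalSubgroup V F).mul_mem
    (Subgroup.subset_closure ⟨v, hv, _, rfl⟩)
    ((verbalSubgroup V F).inv_mem (Subgroup.subset_closure ⟨v, hv, _, rfl⟩))⟩
  have h : QuotientGroup.mk' R (wordValue v (Function.update f i (f i * r))) =
      QuotientGroup.mk' R (wordValue v f) := by
    rw [map_wordValue, map_wordValue]
    congr 1
    funext j
    by_cases hj : j = i
    · subst hj
      simp [hr]
    · simp [hj]
  have h' : QuotientGroup.mk' R (wordValue v (Function.update f i (f i * r)) *
      (wordValue v f)⁻¹) = 1 := by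
    rw [map_mul, map_inv, h, mul_inv_cancel]
  exact (QuotientGroup.eq_one_iff _).1 h'

/-- The Baer invariant `𝓥M(G) = (R ∩ V(F)) / [R V* F]` of `G` with respect to the variety
defined by the set of words `V`, computed from the presentation `π : F → G` with kernel `R`
(to be used for `F` free and `π` surjective). -/
abbrev BaerInvariant (V : Set (FreeGroup ℕ)) {F G : Type*} [Group F] [Group G] (π : F →* G) :=
  ↥(π.ker ⊓ verbalSubgroup V F) ⧸
    (starSubgroup V π.ker).subgroupOf (π.ker ⊓ verbalSubgroup V F)

/-- The cartesian subgroup `⟨[Gᵢ, Gⱼ] | i ≠ j⟩^G` of the free product of the `Gᵢ`. -/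
def cartesianSubgroup {ι : Type*} (G : ι → Type*) [∀ i, Group (G i)] :
    Subgroup (Monoid.CoprodI G) :=
  Subgroup.normalClosure {g | ∃ i j : ι, i ≠ j ∧ ∃ (x : G i) (y : G j),
    g = ⁅(Monoid.CoprodI.of x : Monoid.CoprodI G), (Monoid.CoprodI.of y : Monoid.CoprodI G)⁆}

instance cartesianSubgroup_normal {ι : Type*} (G : ι → Type*) [∀ i, Group (G i)] :
    (cartesianSubgroup G).Normal :=
  Subgroup.normalClosure_normal

/-- The verbal product of the `Gᵢ` for the set of words `V`: the free product modulo the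
intersection of its verbal subgroup with the cartesian subgroup. -/
abbrev VerbalProduct (V : Set (FreeGroup ℕ)) {ι : Type*} (G : ι → Type*) [∀ i, Group (G i)] :=
  Monoid.CoprodI G ⧸ (verbalSubgroup V (Monoid.CoprodI G) ⊓ cartesianSubgroup G)

/-- The `n`th nilpotent product (for `n ≥ 1`) of the `Gᵢ`: the verbal product for the variety of
nilpotent groups of class at most `n`, whose defining word is `γ_{n+1}`. -/
abbrev NilpotentProduct (n : ℕ) {ι : Type*} (G : ι → Type*) [∀ i, Group (G i)] :=
  VerbalProduct {gammaWord 0 n} G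

/-- Witt's formula `χ_n(d) = (1/n) ∑_{k ∣ n} μ(k) d^{n/k}` (for `n ≥ 1`), as a rational number. -/
def wittNumber (n : ℕ) (d : ℚ) : ℚ :=
  (1 / (n : ℚ)) * ∑ k ∈ n.divisors, (ArithmeticFunction.moebius k : ℚ) * d ^ (n / k)

open scoped commutatorElement

/-! Put `a = c₁ + 1`, `b = c₂ + 1`, `N = a + n`. The Baer invariant does not depend on the free
presentation (`nonempty_baerInvariant_mulEquiv`), so one may take `F` free of rank `m` and `R =
γ_{n+1}(F)`. Then `R ∩ V(F) = V(F) = [γ_a, γ_b]`, and `[R V* F]` is `D = [γ_{a+n}, γ_b] [γ_a,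
γ_{b+n}]` (`starSubgroup_outerCommutatorWord`). The task is to show that `[γ_a, γ_b] / D` is free
abelian and to count its rank.

The numerical hypothesis gives `N ≤ 2b`, so `γ_b / γ_N` is abelian. It is free abelian on elements
`z_j` of weights `b ≤ w_j < N`, and Witt's formula counts these by weight. Modulo `D` the commutator
is bilinear on `γ_a × γ_b`, so the `⁅z_j, z_k⁆` generate; discarding those that die in `D` and one
of each antisymmetric pair leaves `basisPairs` (`HasElimination.commutator_le_closure_sup`). For
independence, `γ_b` is itself a free group, so for two coordinates `α`, `β` the cocycle `α(g) β(h)`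
is a coboundary `dl`; the cochain `l` is a homomorphism on `γ_N` and sends `⁅x, y⁆` to `α(x) β(y) -
α(y) β(x)` (`HasElimination.exists_pairing`). These functionals kill `D` and are dual to the
generators.

The `z_j` come from Lazard elimination (`exists_hasElimination`), which also yields `∏ (1 - X^{w_j})
≡ 1 - mX` modulo `X^N`. That congruence gives Witt's formula by logarithmic differentiation and
Möbius inversion (`card_weight_eq_wittNumber`). It also gives independence: in the truncated Magnus
representation the ordered monomials in the `z_j - 1` span, and their number equals the dimension
(`HasElimination.linearIndependent_magnusMonomial`). -/

/-- The lower central series with the classical indexing `γ₁(G) = G`. -/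
def gammaSubgroup (G : Type*) [Group G] (k : ℕ) : Subgroup G :=
  (⊤ : Subgroup G).lowerCentralSeries (k - 1)

/-! ### Lower central series and commutator subgroups. -/

section GammaSubgroup

variable {G : Type*} [Group G]

instance gammaSubgroup_normal (k : ℕ) : (gammaSubgroup G k).Normal := by
  unfold gammaSubgroup; infer_instance

theorem gammaSubgroup_one : gammaSubgroup G 1 = ⊤ := rfl

theorem gammaSubgroup_succ {k : ℕ} (hk : 1 ≤ k) :
    gammaSubgroup G (k + 1) = ⁅gammaSubgroup G k, ⊤⁆ := by
  obtain ⟨k, rfl⟩ := Nat.exists_eq_add_of_le' hk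
  rfl

theorem gammaSubgroup_antitone : Antitone (gammaSubgroup G) := fun _ _ h =>
  Subgroup.lowerCentralSeries_antitone _ (Nat.sub_le_sub_right h 1)

theorem commute_mk_of_commutator_le {N H K : Subgroup G} [N.Normal] (h : ⁅H, K⁆ ≤ N) {x y : G}
    (hx : x ∈ H) (hy : y ∈ K) : Commute (x : G ⧸ N) (y : G ⧸ N) := by
  rw [← commutatorElement_eq_one_iff_commute]
  exact (QuotientGroup.eq_one_iff _).2 (h (Subgroup.commutator_mem_commutator hx hy))

/-- The three subgroups lemma, applied in `G ⧸ N`. -/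
theorem commutator_commutator_le_of_rotate {H₁ H₂ H₃ N : Subgroup G} [N.Normal]
    (h1 : ⁅⁅H₂, H₃⁆, H₁⁆ ≤ N) (h2 : ⁅⁅H₃, H₁⁆, H₂⁆ ≤ N) : ⁅⁅H₁, H₂⁆, H₃⁆ ≤ N := by
  have key : ∀ H : Subgroup G, H ≤ N ↔ H.map (QuotientGroup.mk' N) = ⊥ := fun H => by
    rw [Subgroup.map_eq_bot_iff, QuotientGroup.ker_mk']
  rw [key, Subgroup.map_commutator, Subgroup.map_commutator] at *
  exact Subgroup.commutator_commutator_eq_bot_of_rotate h1 h2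

theorem commutator_gammaSubgroup_le (i j : ℕ) :
    ⁅gammaSubgroup G i, gammaSubgroup G j⁆ ≤ gammaSubgroup G (i + j) := by
  -- By truncated subtraction the term of index `0` is also the whole group, so in that case
  -- normality suffices.
  rcases Nat.eq_zero_or_pos i with rfl | hi
  · simpa using Subgroup.commutator_le_right _ _
  rcases Nat.eq_zero_or_pos j with rfl | hj
  · simpa using Subgroup.commutator_le_left _ _
  induction j, hj using Nat.le_induction generalizing i with
  | base => exact (gammaSubgroup_succ hi).ge
  | succ j hj ih =>
    rw [gammaSubgroup_succ hj, Subgroup.commutator_comm]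
    refine commutator_commutator_le_of_rotate ?_ ?_
    · rw [Subgroup.commutator_comm ⊤, ← gammaSubgroup_succ hi]
      exact (ih _ (by omega)).trans (gammaSubgroup_antitone (by omega))
    · rw [← add_assoc, gammaSubgroup_succ (k := i + j) (by omega)]
      exact Subgroup.commutator_mono (ih _ hi) le_rfl

theorem commutatorElement_mem_gammaSubgroup {i j : ℕ} {x y : G} (hx : x ∈ gammaSubgroup G i)
    (hy : y ∈ gammaSubgroup G j) : ⁅x, y⁆ ∈ gammaSubgroup G (i + j) :=
  commutator_gammaSubgroup_le i j (Subgroup.commutator_mem_commutator hx hy)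

/-- If `S` is stable under conjugation, then so is the set of all `⁅s, x⁆`, and this set generates
`⁅closure S, ⊤⁆`. -/
theorem closure_commutator_top {S : Set G} (hS : ∀ s ∈ S, ∀ g : G, g * s * g⁻¹ ∈ S) :
    Subgroup.closure {g | ∃ s ∈ S, ∃ x : G, g = ⁅s, x⁆} = ⁅Subgroup.closure S, ⊤⁆ := by
  apply le_antisymm
  · rw [Subgroup.closure_le]
    rintro _ ⟨s, hs, x, rfl⟩
    exact Subgroup.commutator_mem_commutator (Subgroup.subset_closure hs) trivial
  · set T := Subgroup.closure {g | ∃ s ∈ S, ∃ x : G, g = ⁅s, x⁆} with hT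
    have : T.Normal := normal_closure_of_conj _ (by
      rintro _ ⟨s, hs, x, rfl⟩ g
      exact ⟨_, hS s hs g, _, conjugate_commutatorElement _ _ _⟩)
    have hle : Subgroup.closure S ≤ (Subgroup.center (G ⧸ T)).comap (QuotientGroup.mk' T) := by
      rw [Subgroup.closure_le]
      intro s hs
      simp only [Subgroup.coe_comap, Set.mem_preimage, SetLike.mem_coe, Subgroup.mem_center_iff]
      intro q
      obtain ⟨x, rfl⟩ := QuotientGroup.mk_surjective q
      refine (commutatorElement_eq_one_iff_mul_comm.1 ?_).symm
      exact (QuotientGroup.eq_one_iff _).2 (Subgroup.subset_closure ⟨s, hs, x, rfl⟩)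
    rw [Subgroup.commutator_le]
    intro g hg x _
    refine (QuotientGroup.eq_one_iff _).1 ?_
    change ⁅(g : G ⧸ T), (x : G ⧸ T)⁆ = 1
    rw [commutatorElement_eq_one_iff_mul_comm]
    exact (Subgroup.mem_center_iff.1 (hle hg) (x : G ⧸ T)).symm

end GammaSubgroup

/-! ### Lazard elimination modulo a term of the lower central series. -/

section Elimination

variable {G : Type*} [Group G]

/-- The ordered product `z₀^{a₀} z₁^{a₁} ⋯`. -/
def orderedProd {r : ℕ} (z : Fin r → G) (a : Fin r → ℤ) : G :=
  (List.ofFn fun j => z j ^ a j).prod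

theorem orderedProd_cons {r : ℕ} (x : G) (z : Fin r → G) (n : ℤ) (a : Fin r → ℤ) :
    orderedProd (Fin.cons x z) (Fin.cons n a : Fin (r + 1) → ℤ) = x ^ n * orderedProd z a := by
  simp [orderedProd, List.ofFn_succ]

/-- The iterated commutator `[u, z, …, z]` with `k` entries `z`. -/
def iterCommutator (u z : G) : ℕ → G
  | 0 => u
  | k + 1 => ⁅iterCommutator u z k, z⁆

theorem iterCommutator_mem {u z : G} {i j : ℕ} (hu : u ∈ gammaSubgroup G i)
    (hz : z ∈ gammaSubgroup G j) (k : ℕ) : iterCommutator u z k ∈ gammaSubgroup G (i + k * j) := by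
  induction k with
  | zero => simpa [iterCommutator] using hu
  | succ k ih =>
    have := commutatorElement_mem_gammaSubgroup ih hz
    rwa [add_assoc, ← Nat.succ_mul] at this

/-- Eliminating `z`: modulo a normal subgroup containing all `[u, z, …, z]` of large length, the
subgroup generated by `z` and `C` is the product of `⟨z⟩` and the subgroup generated by the
`[u, z, …, z]` with `u ∈ C`. -/
theorem exists_zpow_mul_of_mem_closure_insert {M : Subgroup G} [hM : M.Normal] {N : ℕ} {z : G}
    {C : Set G} (h : ∀ u ∈ C, ∀ k, N ≤ k → iterCommutator u z k ∈ M) {g : G}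
    (hg : g ∈ Subgroup.closure (insert z C)) :
    ∃ n : ℤ, ∃ s ∈ Subgroup.closure {x | ∃ u ∈ C, ∃ k < N, x = iterCommutator u z k} ⊔ M,
      g = z ^ n * s := by
  set H := Subgroup.closure {x | ∃ u ∈ C, ∃ k < N, x = iterCommutator u z k} ⊔ M with hH
  have hmem : ∀ u ∈ C, ∀ k, iterCommutator u z k ∈ H := fun u hu k => by
    rcases lt_or_ge k N with hk | hk
    · exact (le_sup_left : _ ≤ H) (Subgroup.subset_closure ⟨u, hu, k, hk, rfl⟩)
    · exact (le_sup_right : _ ≤ H) (h u hu k hk)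
  have hMH : M ≤ H := le_sup_right
  have conj_le : ∀ x : G, (∀ u ∈ C, ∀ k < N, x * iterCommutator u z k * x⁻¹ ∈ H) →
      ∀ y ∈ H, x * y * x⁻¹ ∈ H := by
    intro x hx
    change H ≤ H.comap (MulAut.conj x).toMonoidHom
    refine sup_le ((Subgroup.closure_le _).2 ?_) fun y hy => hMH (hM.conj_mem y hy x)
    rintro _ ⟨u, hu, k, hk, rfl⟩
    exact hx u hu k hk
  have h1 : ∀ y ∈ H, z * y * z⁻¹ ∈ H := by
    refine conj_le z fun u hu k _ => ?_
    have : z * iterCommutator u z k * z⁻¹ =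
        (iterCommutator u z (k + 1))⁻¹ * iterCommutator u z k := by
      simp only [iterCommutator, commutatorElement_def]; group
    rw [this]
    exact H.mul_mem (H.inv_mem (hmem u hu _)) (hmem u hu _)
  have h2 : ∀ y ∈ H, z⁻¹ * y * z⁻¹⁻¹ ∈ H := by
    refine conj_le z⁻¹ fun u hu k _ => ?_
    -- Conjugation by `z⁻¹` expresses the commutator of length `k` through the one of length `k +
    -- 1`, so the induction descends from length `N`, where everything lies in `M`.
    have key : ∀ d k, N ≤ k + d → z⁻¹ * iterCommutator u z k * z⁻¹⁻¹ ∈ H := by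
      intro d
      induction d with
      | zero => exact fun k hk => hMH (hM.conj_mem _ (h u hu k hk) _)
      | succ d ih =>
        intro k hk
        have : z⁻¹ * iterCommutator u z k * z⁻¹⁻¹ =
            (z⁻¹ * iterCommutator u z (k + 1) * z⁻¹⁻¹) * iterCommutator u z k := by
          simp only [iterCommutator, commutatorElement_def]; group
        rw [this]
        exact H.mul_mem (ih (k + 1) (by omega)) (hmem u hu _)
    exact key N k (by omega)
  have hz : z ∈ Subgroup.normalizer (H : Set G) := by
    rw [Subgroup.mem_normalizer_iff]
    refine fun y => ⟨h1 y, fun hy => ?_⟩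
    simpa [mul_assoc] using h2 _ hy
  have hle : Subgroup.closure (insert z C) ≤ Subgroup.zpowers z ⊔ H := by
    rw [Subgroup.closure_le, Set.insert_subset_iff]
    exact ⟨(le_sup_left : _ ≤ Subgroup.zpowers z ⊔ H) (Subgroup.mem_zpowers z),
      fun u hu => (le_sup_right : _ ≤ Subgroup.zpowers z ⊔ H) (hmem u hu 0)⟩
  have hg' : g ∈ ((Subgroup.zpowers z ⊔ H : Subgroup G) : Set G) := hle hg
  rw [Subgroup.coe_mul_of_left_le_normalizer_right _ _
    (by rwa [Subgroup.zpowers_le])] at hg'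
  obtain ⟨_, ⟨n, rfl⟩, s, hs, rfl⟩ := Set.mem_mul.1 hg'
  exact ⟨n, s, hs, rfl⟩

open PowerSeries in
/-- `C` is a multiset of weighted elements; `z`, `w` is a list of weighted elements whose ordered
products represent modulo `γ_N` all elements of the subgroup generated by `C`, with the number of
elements of given weight controlled by a generating function. -/
structure HasElimination (N : ℕ) (C : Multiset (G × ℕ)) {r : ℕ} (z : Fin r → G)
    (w : Fin r → ℕ) : Prop where
  weight_pos : ∀ j, 1 ≤ w j
  weight_lt : ∀ j, w j < N
  mem_gamma : ∀ j, z j ∈ gammaSubgroup G (w j)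
  exists_eq : ∀ g ∈ Subgroup.closure {x | ∃ v, (x, v) ∈ C},
    ∃ a : Fin r → ℤ, ∃ s ∈ gammaSubgroup G N, g = orderedProd z a * s
  dvd_sub : (X : ℚ⟦X⟧) ^ N ∣
    ∏ j, (1 - (X : ℚ⟦X⟧) ^ w j) - (1 - (C.map fun p => (X : ℚ⟦X⟧) ^ p.2).sum)

/-- The weighted iterated commutators `[u, z, …, z]` with `u ∈ C` and between `1` and `N`
entries `z` of weight `v`. -/
def iterCommutators (N : ℕ) (z : G) (v : ℕ) (C : Multiset (G × ℕ)) : Multiset (G × ℕ) :=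
  C.bind fun p => (Multiset.range N).map fun k =>
    (iterCommutator p.1 z (k + 1), p.2 + (k + 1) * v)

theorem mem_iterCommutators {N : ℕ} {z : G} {v : ℕ} {C : Multiset (G × ℕ)} {q : G × ℕ} :
    q ∈ iterCommutators N z v C ↔ ∃ p ∈ C, ∃ k < N,
      q = (iterCommutator p.1 z (k + 1), p.2 + (k + 1) * v) := by
  simp [iterCommutators, eq_comm]

open PowerSeries in
-- Adjoining the commutators with `1, …, N` entries `z` multiplies the generating function of `C` by
-- `1 + X^v + ⋯ + X^{Nv}`, which inverts `1 - X^v` up to terms of degree at least `N`.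
theorem X_pow_dvd_iterCommutators {N v : ℕ} (hv : 1 ≤ v) (z : G) (C : Multiset (G × ℕ)) :
    (X : ℚ⟦X⟧) ^ N ∣ (1 - X ^ v) *
      ((C + iterCommutators N z v C).map fun p => (X : ℚ⟦X⟧) ^ p.2).sum -
        (C.map fun p => (X : ℚ⟦X⟧) ^ p.2).sum := by
  induction C using Multiset.induction with
  | empty => simp [iterCommutators]
  | cons p C ih =>
    have hgeom := mul_neg_geom_sum ((X : ℚ⟦X⟧) ^ v) (N + 1)
    have hp : ((p ::ₘ C + iterCommutators N z v (p ::ₘ C)).map fun p => (X : ℚ⟦X⟧) ^ p.2).sum =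
        X ^ p.2 * (∑ i ∈ Finset.range (N + 1), ((X : ℚ⟦X⟧) ^ v) ^ i) +
        ((C + iterCommutators N z v C).map fun p => (X : ℚ⟦X⟧) ^ p.2).sum := by
      have : ((Multiset.range N).map fun k => (X : ℚ⟦X⟧) ^ (p.2 + (k + 1) * v)).sum =
          X ^ p.2 * ∑ i ∈ Finset.range N, ((X : ℚ⟦X⟧) ^ v) ^ (i + 1) := by
        rw [Finset.mul_sum]
        refine congrArg Multiset.sum (Multiset.map_congr rfl fun k _ => ?_)
        rw [pow_add, mul_comm (k + 1), pow_mul]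
      rw [Finset.sum_range_succ', mul_add, ← this]
      simp only [iterCommutators, Multiset.cons_bind, Multiset.map_add, Multiset.map_cons,
        Multiset.sum_add, Multiset.sum_cons, Multiset.map_map, Function.comp_def]
      ring
    rw [hp, mul_add, mul_left_comm, hgeom, Multiset.map_cons, Multiset.sum_cons]
    have : X ^ p.2 * (1 - ((X : ℚ⟦X⟧) ^ v) ^ (N + 1)) +
        (1 - X ^ v) * ((C + iterCommutators N z v C).map fun p => (X : ℚ⟦X⟧) ^ p.2).sum -
        (X ^ p.2 + (C.map fun p => (X : ℚ⟦X⟧) ^ p.2).sum) =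
        ((1 - X ^ v) * ((C + iterCommutators N z v C).map fun p => (X : ℚ⟦X⟧) ^ p.2).sum -
        (C.map fun p => (X : ℚ⟦X⟧) ^ p.2).sum) - X ^ p.2 * ((X : ℚ⟦X⟧) ^ v) ^ (N + 1) := by ring
    rw [this]
    refine dvd_sub ih (Dvd.dvd.mul_left ?_ _)
    rw [← pow_mul]
    exact pow_dvd_pow _ (by nlinarith)

/-- One elimination: `⟨x, C⟩` is `⟨x⟩` times the group generated by `C'`, the set `C` enlarged by
the iterated commutators with `x`. The generating functions satisfy `1 - X^v - C ≡ (1 - X^v)(1 -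
C')`. -/
theorem HasElimination.cons {N : ℕ} {C : Multiset (G × ℕ)} {r : ℕ} {z : Fin r → G}
    {w : Fin r → ℕ} {x : G} {v : ℕ} (hv : 1 ≤ v) (hvN : v < N) (hx : x ∈ gammaSubgroup G v)
    (hC : ∀ p ∈ C, 1 ≤ p.2 ∧ p.1 ∈ gammaSubgroup G p.2)
    (h : HasElimination N (C + iterCommutators N x v C) z w) :
    HasElimination N ((x, v) ::ₘ C) (Fin.cons x z : Fin (r + 1) → G)
      (Fin.cons v w : Fin (r + 1) → ℕ) where
  weight_pos := Fin.cases hv h.weight_pos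
  weight_lt := Fin.cases hvN h.weight_lt
  mem_gamma := Fin.cases hx h.mem_gamma
  exists_eq := by
    intro g hg
    have hset : {y | ∃ u, (y, u) ∈ (x, v) ::ₘ C} = insert x {y | ∃ u, (y, u) ∈ C} := by
      ext y; simp [exists_or]
    rw [hset] at hg
    obtain ⟨n, s, hs, rfl⟩ := exists_zpow_mul_of_mem_closure_insert (N := N)
      (M := gammaSubgroup G N) (by
        rintro y ⟨u, hy⟩ k hk
        exact gammaSubgroup_antitone (by nlinarith) (iterCommutator_mem (hC _ hy).2 hx k)) hg
    obtain ⟨s₁, hs₁, s₂, hs₂, rfl⟩ := Subgroup.mem_sup_of_normal_right.1 hs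
    obtain ⟨a, s₃, hs₃, rfl⟩ := h.exists_eq s₁ (by
      refine Subgroup.closure_mono ?_ hs₁
      rintro _ ⟨y, ⟨u, hy⟩, k, hk, rfl⟩
      rcases k with _ | k
      · exact ⟨u, Multiset.mem_add.2 (Or.inl hy)⟩
      · exact ⟨_, Multiset.mem_add.2 (Or.inr (mem_iterCommutators.2
          ⟨_, hy, k, by omega, rfl⟩))⟩)
    exact ⟨Fin.cons n a, s₃ * s₂, mul_mem hs₃ hs₂, by rw [orderedProd_cons]; group⟩
  dvd_sub := by
    have h1 := h.dvd_sub
    have h2 := X_pow_dvd_iterCommutators (N := N) hv x C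
    rw [Fin.prod_univ_succ, Multiset.map_cons, Multiset.sum_cons]
    simp only [Fin.cons_zero, Fin.cons_succ]
    have h3 := _root_.dvd_sub (Dvd.dvd.mul_left h1 (1 - PowerSeries.X ^ v)) h2
    convert h3 using 1
    ring

/-- Eliminating an element of minimal weight `s` creates only elements of weight greater than `s`.
Hence a double induction works: on `d = N - s`, and for fixed `s` on the number of elements of
weight `s`. At `s = N` everything lies in `γ_N` and the empty list serves. -/
theorem exists_hasElimination {N : ℕ} (hN : 1 ≤ N) (C : Multiset (G × ℕ))
    (hC : ∀ p ∈ C, 1 ≤ p.2 ∧ p.1 ∈ gammaSubgroup G p.2) :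
    ∃ (r : ℕ) (z : Fin r → G) (w : Fin r → ℕ), HasElimination N C z w := by
  have key : ∀ d s, s + d = N → 1 ≤ s → ∀ C : Multiset (G × ℕ),
      (∀ p ∈ C, s ≤ p.2 ∧ p.1 ∈ gammaSubgroup G p.2) →
      ∃ (r : ℕ) (z : Fin r → G) (w : Fin r → ℕ), HasElimination N C z w := by
    intro d
    induction d with
    | zero =>
      intro s hs _ C hC
      refine ⟨0, Fin.elim0, Fin.elim0, fun j => j.elim0, fun j => j.elim0, fun j => j.elim0,
        fun g hg => ⟨Fin.elim0, g, ?_, by simp [orderedProd]⟩, ?_⟩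
      · refine (Subgroup.closure_le _).2 ?_ hg
        rintro y ⟨u, hy⟩
        exact gammaSubgroup_antitone (by have := (hC _ hy).1; simp at this; omega) (hC _ hy).2
      · simp only [Finset.univ_eq_empty, Finset.prod_empty, sub_sub_cancel]
        refine Multiset.dvd_sum fun y hy => ?_
        obtain ⟨p, hp, rfl⟩ := Multiset.mem_map.1 hy
        exact pow_dvd_pow _ (by have := (hC _ hp).1; omega)
    | succ d ih =>
      intro s hs hs1 C hC
      -- `Z` collects the elements of weight exactly `s`, `U` the heavier ones; new commutators
      -- always go to `U`.
      have split : ∀ Z U : Multiset (G × ℕ), (∀ p ∈ Z, p.2 = s ∧ p.1 ∈ gammaSubgroup G p.2) →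
          (∀ p ∈ U, s + 1 ≤ p.2 ∧ p.1 ∈ gammaSubgroup G p.2) →
          ∃ (r : ℕ) (z : Fin r → G) (w : Fin r → ℕ), HasElimination N (Z + U) z w := by
        intro Z
        induction Z using Multiset.induction with
        | empty =>
          intro U _ hU
          rw [zero_add]
          exact ih (s + 1) (by omega) (by omega) U hU
        | cons p Z ihZ =>
          intro U hZ hU
          obtain ⟨x, v⟩ := p
          obtain ⟨hv, hx⟩ := hZ (x, v) (by simp)
          simp only at hv hx
          subst hv
          have hZU : ∀ p ∈ Z + U, v ≤ p.2 ∧ p.1 ∈ gammaSubgroup G p.2 := by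
            intro p hp
            rcases Multiset.mem_add.1 hp with hp | hp
            · obtain ⟨h1, h2⟩ := hZ p (by simp [hp])
              exact ⟨h1.ge, h2⟩
            · obtain ⟨h1, h2⟩ := hU p hp
              exact ⟨by omega, h2⟩
          obtain ⟨r, z, w, h⟩ := ihZ (U + iterCommutators N x v (Z + U))
            (fun p hp => hZ p (by simp [hp])) (by
              intro p hp
              rcases Multiset.mem_add.1 hp with hp | hp
              · exact hU p hp
              · obtain ⟨q, hq, k, -, rfl⟩ := mem_iterCommutators.1 hp
                refine ⟨?_, iterCommutator_mem (hZU q hq).2 hx _⟩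
                have := (hZU q hq).1
                simp only
                nlinarith)
          refine ⟨r + 1, Fin.cons x z, Fin.cons v w, ?_⟩
          rw [Multiset.cons_add]
          refine HasElimination.cons hs1 (by omega) hx (fun p hp => ?_) (by rwa [add_assoc])
          exact ⟨by have := (hZU p hp).1; omega, (hZU p hp).2⟩
      classical
      rw [← Multiset.filter_add_not (fun p : G × ℕ => p.2 = s) C]
      refine split _ _ (fun p hp => ?_) fun p hp => ?_
      · rw [Multiset.mem_filter] at hp
        exact ⟨hp.2, (hC p hp.1).2⟩
      · rw [Multiset.mem_filter] at hp
        have := (hC p hp.1).1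
        exact ⟨by omega, (hC p hp.1).2⟩
  exact key (N - 1) 1 (by omega) le_rfl C hC

end Elimination

/-! ### Witt's formula from the product identity. -/

section Witt

open PowerSeries

variable {r : ℕ} {w : Fin r → ℕ}

/-- The series `d X^d / (1 - X^d)`. -/
noncomputable def divisorSeries (d : ℕ) : ℚ⟦X⟧ :=
  PowerSeries.mk fun k => if 1 ≤ k ∧ d ∣ k then (d : ℚ) else 0

theorem one_sub_mul_divisorSeries {d : ℕ} (hd : 1 ≤ d) :
    (1 - (X : ℚ⟦X⟧) ^ d) * divisorSeries d = (d : ℚ⟦X⟧) * X ^ d := by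
  ext k
  rw [sub_mul, one_mul, map_sub, coeff_X_pow_mul', ← nsmul_eq_mul, map_nsmul, coeff_X_pow]
  simp only [divisorSeries, coeff_mk]
  rcases lt_trichotomy k d with h | rfl | h
  · rw [if_neg (show ¬d ≤ k by omega), if_neg (show k ≠ d by omega), if_neg]
    · simp
    · rintro ⟨h1, h2⟩
      exact absurd (Nat.le_of_dvd h1 h2) (by omega)
  · simp [hd]
  · have : d ∣ k - d ↔ d ∣ k := Nat.dvd_sub_self_right.trans (or_iff_left h.not_ge)
    simp only [if_pos h.le, if_neg (show k ≠ d by omega), this]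
    simp [show 1 ≤ k by omega, show 1 ≤ k - d by omega]

/-- The logarithmic derivative `X f' / f = -∑ d X^d / (1 - X^d)` of a product of factors `1 - X^d`,
with denominators cleared. -/
theorem X_mul_derivative_prod (hw : ∀ j, 1 ≤ w j) (s : Finset (Fin r)) :
    X * d⁄dX ℚ (∏ j ∈ s, (1 - (X : ℚ⟦X⟧) ^ w j)) +
      (∏ j ∈ s, (1 - (X : ℚ⟦X⟧) ^ w j)) * ∑ j ∈ s, divisorSeries (w j) = 0 := by
  classical
  induction s using Finset.induction_on with
  | empty => simp
  | insert j s hj ih =>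
    rw [Finset.prod_insert hj, Finset.sum_insert hj, Derivation.leibniz, smul_eq_mul, smul_eq_mul]
    have h1 : X * d⁄dX ℚ (1 - (X : ℚ⟦X⟧) ^ w j) = -((w j : ℚ⟦X⟧) * X ^ w j) := by
      obtain ⟨d, hd⟩ := Nat.exists_eq_add_of_le' (hw j)
      rw [map_sub, derivative_one, derivative_pow, derivative_X, hd]
      simp only [Nat.add_sub_cancel]
      ring
    have h2 := one_sub_mul_divisorSeries (hw j)
    linear_combination (1 - (X : ℚ⟦X⟧) ^ w j) * ih +
      (∏ j ∈ s, (1 - (X : ℚ⟦X⟧) ^ w j)) * (h1 + h2)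

/-- Since the product agrees with `1 - mX` up to degree `N`, so do the logarithmic derivatives, and
that of `1 - mX` is `-∑ m^k X^k`. -/
theorem coeff_sum_divisorSeries {N m : ℕ} (hw : ∀ j, 1 ≤ w j)
    (h : (X : ℚ⟦X⟧) ^ N ∣ ∏ j, (1 - (X : ℚ⟦X⟧) ^ w j) - (1 - (m : ℚ⟦X⟧) * X)) {k : ℕ}
    (hk : 1 ≤ k) (hkN : k < N) : coeff k (∑ j, divisorSeries (w j)) = (m : ℚ) ^ k := by
  set f := ∏ j, (1 - (X : ℚ⟦X⟧) ^ w j) with hf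
  set σ := ∑ j, divisorSeries (w j) with hσ
  have h0 : X * d⁄dX ℚ f + f * σ = 0 := X_mul_derivative_prod hw Finset.univ
  -- The operator `X d/dX` multiplies the `i`th coefficient by `i`, so it loses no order of
  -- congruence, unlike `d/dX` alone.
  have h1 : (X : ℚ⟦X⟧) ^ N ∣ X * d⁄dX ℚ f + (m : ℚ⟦X⟧) * X := by
    rw [X_pow_dvd_iff] at h ⊢
    intro i hi
    have hi' := h i hi
    rw [map_sub, sub_eq_zero] at hi'
    have : coeff i (X * d⁄dX ℚ f) = coeff i f * i := by
      cases i with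
      | zero => simp
      | succ i => rw [coeff_succ_X_mul, coeff_derivative]; push_cast; ring
    rw [map_add, this, hi', map_sub, ← nsmul_eq_mul, map_nsmul, coeff_X, coeff_one]
    rcases i with _ | _ | i <;> simp
  have h2 : (X : ℚ⟦X⟧) ^ N ∣ (1 - (m : ℚ⟦X⟧) * X) * σ - (m : ℚ⟦X⟧) * X := by
    have := dvd_sub (dvd_neg.2 h1) (Dvd.dvd.mul_right h σ)
    convert this using 1
    linear_combination h0
  rw [X_pow_dvd_iff] at h2
  have hσ0 : coeff 0 σ = 0 := by simp [hσ, divisorSeries]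
  have hrec : ∀ i, i + 1 < N →
      coeff (i + 1) σ = m * coeff i σ + (if i = 0 then (m : ℚ) else 0) := by
    intro i hi
    have := h2 (i + 1) hi
    have e : (1 - (m : ℚ⟦X⟧) * X) * σ - (m : ℚ⟦X⟧) * X = σ - m • (X * σ) - m • X := by
      simp only [nsmul_eq_mul]; ring
    rw [e, map_sub, map_sub, map_nsmul, map_nsmul, coeff_succ_X_mul, coeff_X] at this
    simp only [nsmul_eq_mul, Nat.add_eq_right] at this
    split_ifs at this ⊢ <;> linarith
  induction k, hk using Nat.le_induction with
  | base => rw [show (1 : ℕ) = 0 + 1 from rfl, hrec 0 hkN, hσ0]; simp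
  | succ k hk ih =>
    rw [hrec k hkN, ih (by omega), if_neg (by omega)]; ring

/-- Comparing coefficients of `X^k` gives `∑_{d ∣ k} d · #{j | w_j = d} = m^k` for `1 ≤ k < N`. This
range is closed under divisors, so Möbius inversion applies on it. -/
theorem card_weight_eq_wittNumber {N m : ℕ} (hw : ∀ j, 1 ≤ w j)
    (h : (X : ℚ⟦X⟧) ^ N ∣ ∏ j, (1 - (X : ℚ⟦X⟧) ^ w j) - (1 - (m : ℚ⟦X⟧) * X)) {i : ℕ}
    (hi : 1 ≤ i) (hiN : i < N) :
    ((Finset.univ.filter fun j => w j = i).card : ℚ) = wittNumber i m := by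
  have hsum : ∀ k, 1 ≤ k → k < N → ∑ d ∈ k.divisors,
      (d : ℚ) * ((Finset.univ.filter fun j => w j = d).card : ℚ) = (m : ℚ) ^ k := by
    intro k hk hkN
    rw [← coeff_sum_divisorSeries hw h hk hkN, map_sum]
    simp only [divisorSeries, coeff_mk, hk, true_and]
    rw [← Finset.sum_filter, ← Finset.sum_fiberwise_of_maps_to
      (g := w) (t := k.divisors) (fun j hj => by
        rw [Finset.mem_filter] at hj
        exact Nat.mem_divisors.2 ⟨hj.2, by omega⟩)]
    refine Finset.sum_congr rfl fun d hd => ?_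
    rw [Finset.filter_filter, Finset.sum_congr rfl (g := fun _ => (d : ℚ)) (fun j hj => by
      rw [Finset.mem_filter] at hj; rw [hj.2.2]), Finset.sum_const, nsmul_eq_mul, mul_comm]
    congr 3
    ext j
    have := (Nat.mem_divisors.1 hd).1
    simp only [Finset.mem_filter, Finset.mem_univ, true_and]
    exact ⟨fun h => ⟨h ▸ this, h⟩, fun h => h.2⟩
  have hmob := (ArithmeticFunction.sum_eq_iff_sum_mul_moebius_eq_on (R := ℚ)
    (f := fun d => (d : ℚ) * ((Finset.univ.filter fun j => w j = d).card : ℚ))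
    (g := fun k => (m : ℚ) ^ k) {k | 1 ≤ k ∧ k < N} (fun a b hab hb =>
      ⟨Nat.pos_of_dvd_of_pos hab hb.1, (Nat.le_of_dvd hb.1 hab).trans_lt hb.2⟩)).1
    (fun k hk hkN => hsum k hk hkN.2) i hi ⟨hi, hiN⟩
  have hi0 : (i : ℚ) ≠ 0 := by positivity
  rw [wittNumber, ← Nat.sum_divisorsAntidiagonal
    (f := fun k e => (ArithmeticFunction.moebius k : ℚ) * (m : ℚ) ^ e), hmob]
  field_simp

end Witt

/-! ### Ordered products and powers of unipotent units. -/

theorem prod_ofFn_one_add {A : Type*} [Ring A] {r : ℕ} {Q : Fin r → A} (h : ∀ i j, Q i * Q j = 0) :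
    (List.ofFn fun j => 1 + Q j).prod = 1 + ∑ j, Q j := by
  induction r with
  | zero => simp
  | succ r ih =>
    have h0 : Q 0 * ∑ j : Fin r, Q j.succ = 0 := by
      rw [Finset.mul_sum]; exact Finset.sum_eq_zero fun j _ => h 0 j.succ
    rw [List.ofFn_succ, List.prod_cons, ih fun i j => h i.succ j.succ, Fin.sum_univ_succ, mul_add,
      mul_one, add_mul, one_mul, h0]
    abel

theorem prod_ofFn_pow_single {A : Type*} [Ring A] {r : ℕ} (P : Fin r → A) (j : Fin r) :
    (List.ofFn fun i => P i ^ (Pi.single j 1 : Fin r → ℕ) i).prod = P j := by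
  induction r with
  | zero => exact j.elim0
  | succ r ih =>
    rw [List.ofFn_succ, List.prod_cons]
    cases j using Fin.cases with
    | zero =>
      simp [Fin.succ_ne_zero, List.ofFn_const]
    | succ j =>
      have := ih (fun i => P i.succ) j
      simp only [Pi.single_apply, Fin.succ_inj, (Fin.succ_ne_zero j).symm, if_false, pow_zero,
        one_mul] at this ⊢
      exact this

section NilpotentUnits

variable {A : Type*} [Ring A] [Algebra ℚ A]

/-- `u = 1 + (u - 1)` is already invertible in the subalgebra generated by the nilpotent `u - 1`,
and inverses are unique. -/
theorem Units.inv_mem_adjoin_of_isNilpotent (u : Aˣ) (hu : IsNilpotent ((u : A) - 1)) :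
    ((u⁻¹ : Aˣ) : A) ∈ Algebra.adjoin ℚ {(u : A) - 1} := by
  set B := Algebra.adjoin ℚ {(u : A) - 1} with hB
  have hP : (u : A) - 1 ∈ B := Algebra.subset_adjoin rfl
  have hn : IsNilpotent (⟨_, hP⟩ : B) := by
    obtain ⟨n, hn⟩ := hu
    exact ⟨n, Subtype.ext (by simpa using hn)⟩
  obtain ⟨v, hv⟩ := hn.isUnit_one_add
  have h1 : ((v : B) : A) = u := by rw [hv]; simp
  have h2 : ((v⁻¹ : Bˣ) : B) * (v : B) = 1 := v.inv_mul
  have h3 : (((v⁻¹ : Bˣ) : B) : A) * u = 1 := by rw [← h1]; exact congrArg Subtype.val h2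
  rw [← Units.eq_inv_of_mul_eq_one_right h3]
  exact Subtype.prop _

theorem Units.zpow_mem_span_pow_of_isNilpotent (u : Aˣ) (hu : IsNilpotent ((u : A) - 1)) (n : ℤ) :
    ((u ^ n : Aˣ) : A) ∈ Submodule.span ℚ (Set.range fun k : ℕ => ((u : A) - 1) ^ k) := by
  have h : ((u ^ n : Aˣ) : A) ∈ Algebra.adjoin ℚ {(u : A) - 1} := by
    have h1 : (u : A) ∈ Algebra.adjoin ℚ {(u : A) - 1} := by
      have := add_mem (Algebra.subset_adjoin (R := ℚ) (Set.mem_singleton ((u : A) - 1)))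
        (one_mem (Algebra.adjoin ℚ {(u : A) - 1}))
      rwa [sub_add_cancel] at this
    cases n with
    | ofNat n => simpa using pow_mem h1 n
    | negSucc n =>
      rw [zpow_negSucc, ← inv_pow, Units.val_pow_eq_pow_val]
      exact pow_mem (u.inv_mem_adjoin_of_isNilpotent hu) _
  rw [← Subalgebra.mem_toSubmodule, Algebra.adjoin_eq_span] at h
  refine Submodule.span_mono ?_ h
  intro x hx
  obtain ⟨k, rfl⟩ := Submonoid.mem_closure_singleton.1 hx
  exact ⟨k, rfl⟩

theorem Units.zpow_eq_one_add_of_sq_eq_zero (u : Aˣ) {P : A} (hu : (u : A) = 1 + P)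
    (hP : P * P = 0) (n : ℤ) : ((u ^ n : Aˣ) : A) = 1 + (n : ℚ) • P := by
  have hinv : ((u⁻¹ : Aˣ) : A) = 1 - P := by
    refine (Units.eq_inv_of_mul_eq_one_left ?_).symm
    rw [hu, add_mul, one_mul, mul_sub, hP, mul_one]; simp
  induction n using Int.induction_on with
  | zero => simp
  | succ n ih =>
    rw [zpow_add_one, Units.val_mul, ih, hu]
    simp only [mul_add, add_mul, one_mul, mul_one, smul_mul_assoc, hP]
    push_cast
    module
  | pred n ih =>
    rw [zpow_sub_one, Units.val_mul, ih, hinv]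
    simp only [mul_sub, add_mul, one_mul, mul_one, smul_mul_assoc, hP]
    push_cast
    module

theorem prod_ofFn_mem_span {r : ℕ} {P T : Fin r → A}
    (h : ∀ j, T j ∈ Submodule.span ℚ (Set.range fun k : ℕ => P j ^ k)) :
    (List.ofFn T).prod ∈
      Submodule.span ℚ (Set.range fun e : Fin r → ℕ => (List.ofFn fun j => P j ^ e j).prod) := by
  induction r with
  | zero => exact Submodule.subset_span ⟨Fin.elim0, by simp⟩
  | succ r ih =>
    rw [List.ofFn_succ, List.prod_cons]
    have := Submodule.mul_mem_mul (h 0) (ih fun j => h j.succ)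
    rw [Submodule.span_mul_span] at this
    refine Submodule.span_mono ?_ this
    rintro _ ⟨_, ⟨k, rfl⟩, _, ⟨e, rfl⟩, rfl⟩
    exact ⟨Fin.cons k e, by simp [List.ofFn_succ]⟩

end NilpotentUnits

/-! ### Counting monomials of bounded weight. -/

section Counting

open PowerSeries

/-- Exponent vectors `e` with `∑ e_j w_j ≤ v` (for positive weights `w_j`). -/
def boundedExponents {r : ℕ} (w : Fin r → ℕ) (v : ℕ) : Finset (Fin r → ℕ) :=
  (Fintype.piFinset fun _ => Finset.range (v + 1)).filter fun e => ∑ j, e j * w j ≤ v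

theorem mem_boundedExponents {r : ℕ} {w : Fin r → ℕ} (hw : ∀ j, 1 ≤ w j) {v : ℕ}
    {e : Fin r → ℕ} : e ∈ boundedExponents w v ↔ ∑ j, e j * w j ≤ v := by
  simp only [boundedExponents, Finset.mem_filter, Fintype.mem_piFinset, Finset.mem_range,
    and_iff_right_iff_imp]
  intro h j
  have h1 : e j * w j ≤ ∑ j, e j * w j :=
    Finset.single_le_sum (f := fun j => e j * w j) (fun _ _ => Nat.zero_le _) (Finset.mem_univ j)
  have h2 := Nat.le_mul_of_pos_right (e j) (hw j)
  omega

/-- The product `Q` of truncated geometric series counts exponent vectors by weight up to `v`. It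
inverts `∏ (1 - X^{w_j}) ≡ 1 - mX`, so its coefficients there are those of `1 / (1 - mX)`. -/
theorem card_boundedExponents {r N m : ℕ} {w : Fin r → ℕ} (hw : ∀ j, 1 ≤ w j)
    (h : (X : ℚ⟦X⟧) ^ N ∣ ∏ j, (1 - (X : ℚ⟦X⟧) ^ w j) - (1 - (m : ℚ⟦X⟧) * X)) {v : ℕ}
    (hv : v < N) : (boundedExponents w v).card = ∑ k ∈ Finset.range (v + 1), m ^ k := by
  set Q := ∏ j, ∑ i ∈ Finset.range (v + 1), ((X : ℚ⟦X⟧) ^ w j) ^ i with hQ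
  have hcoeff : ∀ k, coeff k Q = (((Fintype.piFinset fun _ : Fin r => Finset.range (v + 1)).filter
      fun e => ∑ j, e j * w j = k).card : ℚ) := by
    intro k
    rw [hQ, Finset.prod_univ_sum, map_sum, Finset.card_filter, Nat.cast_sum]
    refine Finset.sum_congr rfl fun e _ => ?_
    simp_rw [← pow_mul]
    rw [Finset.prod_pow_eq_pow_sum, coeff_X_pow]
    simp_rw [mul_comm (w _), eq_comm (a := k)]
    push_cast
    rfl
  have h1 : (∏ j, (1 - (X : ℚ⟦X⟧) ^ w j)) * Q = ∏ j, (1 - ((X : ℚ⟦X⟧) ^ w j) ^ (v + 1)) := by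
    rw [hQ, ← Finset.prod_mul_distrib]
    exact Finset.prod_congr rfl fun j _ => mul_neg_geom_sum _ _
  have h2 : ∀ s : Finset (Fin r), (X : ℚ⟦X⟧) ^ (v + 1) ∣
      ∏ j ∈ s, (1 - ((X : ℚ⟦X⟧) ^ w j) ^ (v + 1)) - 1 := by
    classical
    intro s
    induction s using Finset.induction_on with
    | empty => simp
    | insert j s hj ih =>
      rw [Finset.prod_insert hj, sub_mul, one_mul, sub_right_comm]
      refine dvd_sub ih (Dvd.dvd.mul_right ?_ _)
      rw [← pow_mul]
      exact pow_dvd_pow _ (Nat.le_mul_of_pos_left _ (hw j))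
  have h3 : (X : ℚ⟦X⟧) ^ (v + 1) ∣ (1 - (m : ℚ⟦X⟧) * X) * Q - 1 := by
    have := dvd_sub (h2 Finset.univ)
      (Dvd.dvd.mul_right ((pow_dvd_pow (X : ℚ⟦X⟧) (show v + 1 ≤ N by omega)).trans h) Q)
    convert this using 1
    linear_combination h1
  rw [X_pow_dvd_iff] at h3
  have h4 : ∀ k, k < v + 1 → coeff k Q = (m : ℚ) ^ k := by
    have e : (1 - (m : ℚ⟦X⟧) * X) * Q - 1 = Q - m • (X * Q) - 1 := by
      simp only [nsmul_eq_mul]; ring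
    rw [e] at h3
    intro k
    induction k with
    | zero =>
      intro hk
      have := h3 0 hk
      rw [map_sub, map_sub, map_nsmul, coeff_zero_X_mul, coeff_one, smul_zero, if_pos rfl] at this
      rw [pow_zero]; linarith
    | succ k ih =>
      intro hk
      have := h3 (k + 1) hk
      rw [map_sub, map_sub, map_nsmul, coeff_succ_X_mul, coeff_one, if_neg (by omega),
        ih (by omega), nsmul_eq_mul] at this
      rw [pow_succ']; linarith
  rw [Finset.card_eq_sum_card_fiberwise (f := fun e => ∑ j, e j * w j)
    (t := Finset.range (v + 1)) (by
      intro e he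
      have := (mem_boundedExponents hw).1 he
      simpa [Nat.lt_succ_iff] using this)]
  refine Finset.sum_congr rfl fun k hk => ?_
  have hk' := Finset.mem_range.1 hk
  have := (hcoeff k).symm.trans (h4 k hk')
  rw [← Nat.cast_pow, Nat.cast_inj] at this
  rw [← this, boundedExponents, Finset.filter_filter]
  congr 1
  ext e
  simp only [Finset.mem_filter, and_congr_right_iff, and_iff_right_iff_imp]
  intro _ h
  omega

end Counting

/-! ### The truncated Magnus representation. -/

theorem mul_sub_mul_eq_sub_one {A : Type*} [Ring A] (a b : A) :
    (a - 1) * (b - 1) - (b - 1) * (a - 1) = a * b - b * a := by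
  noncomm_ring

section Magnus

/-- Words of length at most `v` in `m` letters. -/
abbrev BoundedWord (m v : ℕ) := {l : List (Fin m) // l.length ≤ v}

/-- Bounded words are vectors of bounded length. -/
def boundedWordEquiv (m v : ℕ) : BoundedWord m v ≃ Σ k : Fin (v + 1), List.Vector (Fin m) k where
  toFun l := ⟨⟨l.1.length, Nat.lt_succ_of_le l.2⟩, ⟨l.1, rfl⟩⟩
  invFun x := ⟨x.2.1, by rw [x.2.2]; exact Nat.le_of_lt_succ x.1.2⟩
  left_inv _ := rfl
  right_inv := by
    rintro ⟨⟨k, hk⟩, ⟨l, h⟩⟩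
    obtain rfl : l.length = k := h
    rfl

instance (m v : ℕ) : Fintype (BoundedWord m v) := Fintype.ofEquiv _ (boundedWordEquiv m v).symm

theorem card_boundedWord (m v : ℕ) :
    Fintype.card (BoundedWord m v) = ∑ k ∈ Finset.range (v + 1), m ^ k := by
  rw [Fintype.card_congr (boundedWordEquiv m v), Fintype.card_sigma, Finset.sum_range]
  simp

variable {m v : ℕ}

/-- Functions on bounded words, thought of as truncated noncommutative polynomials. -/
abbrev WordSpace (m v : ℕ) := BoundedWord m v → ℚ

/-- Functions vanishing on words of length less than `j`. -/
def wordFiltration (m v j : ℕ) : Submodule ℚ (WordSpace m v) where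
  carrier := {f | ∀ l, l.1.length < j → f l = 0}
  add_mem' hf hg l hl := by simp [hf l hl, hg l hl]
  zero_mem' _ _ := rfl
  smul_mem' c f hf l hl := by simp [hf l hl]

/-- Operators raising the filtration of `WordSpace m v` by `i`. -/
def operatorFiltration (m v i : ℕ) : Submodule ℚ (Module.End ℚ (WordSpace m v)) where
  carrier := {T | ∀ j, ∀ f ∈ wordFiltration m v j, T f ∈ wordFiltration m v (i + j)}
  add_mem' hT hS j f hf := add_mem (hT j f hf) (hS j f hf)
  zero_mem' _ _ _ := zero_mem _
  smul_mem' c _ hT j f hf := Submodule.smul_mem _ c (hT j f hf)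

theorem operatorFiltration_antitone : Antitone (operatorFiltration m v) :=
  fun _ _ h _ hT j f hf l hl => hT j f hf l (by omega)

theorem mul_mem_operatorFiltration {i j : ℕ} {T S : Module.End ℚ (WordSpace m v)}
    (hT : T ∈ operatorFiltration m v i) (hS : S ∈ operatorFiltration m v j) :
    T * S ∈ operatorFiltration m v (i + j) := by
  intro k f hf
  rw [add_assoc]
  exact hT _ _ (hS _ _ hf)

theorem one_mem_operatorFiltration : (1 : Module.End ℚ (WordSpace m v)) ∈
    operatorFiltration m v 0 := by
  intro j f hf
  simpa using hf

theorem pow_mem_operatorFiltration {i : ℕ} {T : Module.End ℚ (WordSpace m v)}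
    (hT : T ∈ operatorFiltration m v i) (k : ℕ) : T ^ k ∈ operatorFiltration m v (k * i) := by
  induction k with
  | zero => simpa using one_mem_operatorFiltration
  | succ k ih =>
    rw [pow_succ, Nat.succ_mul]
    exact mul_mem_operatorFiltration ih hT

theorem eq_zero_of_mem_operatorFiltration {i : ℕ} {T : Module.End ℚ (WordSpace m v)}
    (hT : T ∈ operatorFiltration m v i) (hi : v < i) : T = 0 := by
  refine LinearMap.ext fun f => funext fun l => ?_
  exact hT 0 f (fun _ h => absurd h (Nat.not_lt_zero _)) l (by have := l.2; omega)

theorem isNilpotent_of_mem_operatorFiltration {i : ℕ} {T : Module.End ℚ (WordSpace m v)}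
    (hT : T ∈ operatorFiltration m v i) (hi : 1 ≤ i) : IsNilpotent T :=
  ⟨v + 1, eq_zero_of_mem_operatorFiltration (pow_mem_operatorFiltration hT (v + 1)) (by nlinarith)⟩

/-- The letter `x` acts by sending a word `l` to `x l` (or to `0` if this is too long). -/
def letterOperator (m v : ℕ) (x : Fin m) : Module.End ℚ (WordSpace m v) where
  toFun f
    | ⟨[], _⟩ => 0
    | ⟨y :: t, h⟩ => if y = x then f ⟨t, (Nat.le_succ _).trans h⟩ else 0
  map_add' f g := by
    funext ⟨l, h⟩
    cases l with
    | nil => simp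
    | cons y t => by_cases hy : y = x <;> simp [hy]
  map_smul' c f := by
    funext ⟨l, h⟩
    cases l with
    | nil => simp
    | cons y t => by_cases hy : y = x <;> simp [hy]

theorem letterOperator_mem (x : Fin m) : letterOperator m v x ∈ operatorFiltration m v 1 := by
  rintro j f hf ⟨l, h⟩ hl
  cases l with
  | nil => rfl
  | cons y t =>
    by_cases hy : y = x
    · have := hf ⟨t, (Nat.le_succ _).trans h⟩ (by simp only [List.length_cons] at hl ⊢; omega)
      simpa [letterOperator, hy] using this
    · simp [letterOperator, hy]

theorem letterOperator_single (x : Fin m) (l : List (Fin m)) (h : (x :: l).length ≤ v) :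
    letterOperator m v x (Pi.single ⟨l, (Nat.le_succ _).trans h⟩ 1) = Pi.single ⟨x :: l, h⟩ 1 := by
  funext ⟨t, ht⟩
  cases t with
  | nil => simp [letterOperator]
  | cons y t => by_cases hy : y = x <;> simp [letterOperator, Pi.single_apply, hy]

/-- The Magnus representation: the letter `x` acts by `1 + letterOperator x`. -/
noncomputable def magnus (m v : ℕ) : FreeGroup (Fin m) →* (Module.End ℚ (WordSpace m v))ˣ :=
  FreeGroup.lift fun x =>
    (isNilpotent_of_mem_operatorFiltration (letterOperator_mem x) le_rfl).isUnit_one_add.unit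

theorem magnus_of (x : Fin m) :
    (magnus m v (FreeGroup.of x) : Module.End ℚ (WordSpace m v)) = 1 + letterOperator m v x := by
  simp [magnus]

theorem magnus_mem (g : FreeGroup (Fin m)) :
    (magnus m v g : Module.End ℚ (WordSpace m v)) ∈ operatorFiltration m v 0 := by
  let B : Subalgebra ℚ (Module.End ℚ (WordSpace m v)) :=
    (operatorFiltration m v 0).toSubalgebra one_mem_operatorFiltration
      fun _ _ hT hS => mul_mem_operatorFiltration hT hS
  change _ ∈ B
  have hx : ∀ x : Fin m, letterOperator m v x ∈ B := fun x =>
    operatorFiltration_antitone (Nat.zero_le 1) (letterOperator_mem x)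
  induction g using FreeGroup.induction_on with
  | C1 => simp
  | of x => rw [magnus_of]; exact add_mem (one_mem B) (hx x)
  | inv_of x _ =>
    rw [map_inv]
    have hu : (magnus m v (FreeGroup.of x) : Module.End ℚ (WordSpace m v)) - 1 =
        letterOperator m v x := by rw [magnus_of, add_sub_cancel_left]
    have := (magnus m v (FreeGroup.of x)).inv_mem_adjoin_of_isNilpotent (by
      rw [hu]; exact isNilpotent_of_mem_operatorFiltration (letterOperator_mem x) le_rfl)
    rw [hu] at this
    exact Algebra.adjoin_le (Set.singleton_subset_iff.2 (hx x)) this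
  | mul g h hg hh => rw [map_mul, Units.val_mul]; exact mul_mem hg hh

/-- The elements of the free group acting trivially modulo `operatorFiltration m v i`. -/
def magnusSubgroup (m v i : ℕ) : Subgroup (FreeGroup (Fin m)) where
  carrier := {g | (magnus m v g : Module.End ℚ (WordSpace m v)) - 1 ∈ operatorFiltration m v i}
  one_mem' := by simp
  mul_mem' := by
    intro g h hg hh
    have e : ((magnus m v (g * h) : _) : Module.End ℚ (WordSpace m v)) - 1 =
        ((magnus m v g : _) - 1) * (magnus m v h : _) + ((magnus m v h : _) - 1) := by
      rw [map_mul, Units.val_mul, sub_mul, one_mul, sub_add_sub_cancel]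
    change _ ∈ operatorFiltration m v i
    rw [e]
    exact add_mem (mul_mem_operatorFiltration hg (magnus_mem h)) hh
  inv_mem' := by
    intro g hg
    have e : ((magnus m v g⁻¹ : _) : Module.End ℚ (WordSpace m v)) - 1 =
        -(((magnus m v g : _) - 1) * (magnus m v g⁻¹ : _)) := by
      rw [map_inv, sub_mul, Units.mul_inv, one_mul, neg_sub]
    change _ ∈ operatorFiltration m v i
    rw [e]
    exact neg_mem (mul_mem_operatorFiltration hg (magnus_mem _))

theorem magnusSubgroup_one : magnusSubgroup m v 1 = ⊤ := by
  rw [eq_top_iff, ← FreeGroup.closure_range_of, Subgroup.closure_le]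
  rintro _ ⟨x, rfl⟩
  change _ ∈ operatorFiltration m v 1
  rw [magnus_of, add_sub_cancel_left]
  exact letterOperator_mem x

theorem gammaSubgroup_le_magnusSubgroup {i : ℕ} (hi : 1 ≤ i) :
    gammaSubgroup (FreeGroup (Fin m)) i ≤ magnusSubgroup m v i := by
  induction i, hi using Nat.le_induction with
  | base => rw [magnusSubgroup_one]; exact le_top
  | succ i hi ih =>
    rw [gammaSubgroup_succ hi, Subgroup.commutator_le]
    intro g hg h _
    have hg' : (magnus m v g : Module.End ℚ (WordSpace m v)) - 1 ∈ operatorFiltration m v i :=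
      ih hg
    have hh' : (magnus m v h : Module.End ℚ (WordSpace m v)) - 1 ∈ operatorFiltration m v 1 :=
      (magnusSubgroup_one (m := m) (v := v)).ge (Subgroup.mem_top h)
    change _ ∈ operatorFiltration m v (i + 1)
    -- With `g` and `h` standing for their images, `⁅g, h⁆ - 1 = (gh - hg)(hg)⁻¹`, and `gh - hg` is
    -- the ring commutator of `g - 1` and `h - 1`, whose filtration degrees add.
    have e : ((magnus m v ⁅g, h⁆ : _) : Module.End ℚ (WordSpace m v)) - 1 =
        (((magnus m v g : _) - 1) * ((magnus m v h : _) - 1) -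
          ((magnus m v h : _) - 1) * ((magnus m v g : _) - 1)) * (magnus m v (h * g)⁻¹ : _) := by
      have e1 : ((magnus m v (g * h) : _) : Module.End ℚ (WordSpace m v)) *
          (magnus m v (h * g)⁻¹ : _) = (magnus m v ⁅g, h⁆ : _) := by
        rw [← Units.val_mul, ← map_mul, commutatorElement_def]; congr 2; group
      have e2 : ((magnus m v (h * g) : _) : Module.End ℚ (WordSpace m v)) *
          (magnus m v (h * g)⁻¹ : _) = 1 := by
        rw [map_inv, Units.mul_inv]
      rw [mul_sub_mul_eq_sub_one, ← Units.val_mul, ← Units.val_mul, ← map_mul, ← map_mul, sub_mul,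
        e1, e2]
    rw [e]
    have hhg := mul_mem_operatorFiltration hh' hg'
    rw [add_comm] at hhg
    exact mul_mem_operatorFiltration (j := 0)
      (sub_mem (mul_mem_operatorFiltration hg' hh') hhg) (magnus_mem _)

/-- The empty word. -/
def emptyWord (m v : ℕ) : WordSpace m v := Pi.single ⟨[], Nat.zero_le _⟩ 1

/-- The span is stable under each letter operator, which is a difference of two group elements, and
the letters build every word from the empty one. -/
theorem span_magnus_emptyWord : Submodule.span ℚ (Set.range fun g : FreeGroup (Fin m) =>
    (magnus m v g : Module.End ℚ (WordSpace m v)) (emptyWord m v)) = ⊤ := by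
  set S := Submodule.span ℚ (Set.range fun g : FreeGroup (Fin m) =>
    (magnus m v g : Module.End ℚ (WordSpace m v)) (emptyWord m v)) with hS
  have hstab : ∀ x : Fin m, S ≤ S.comap (letterOperator m v x) := by
    intro x
    rw [hS, Submodule.span_le]
    rintro _ ⟨g, rfl⟩
    change letterOperator m v x _ ∈ S
    have : letterOperator m v x = (magnus m v (FreeGroup.of x) : _) - 1 := by
      rw [magnus_of, add_sub_cancel_left]
    rw [this, LinearMap.sub_apply, Module.End.one_apply]
    refine sub_mem (Submodule.subset_span ⟨FreeGroup.of x * g, ?_⟩) (Submodule.subset_span ⟨g, rfl⟩)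
    simp only [map_mul, Units.val_mul, Module.End.mul_apply]
  have hword : ∀ (l : List (Fin m)) (h : l.length ≤ v),
      (Pi.single ⟨l, h⟩ 1 : WordSpace m v) ∈ S := by
    intro l
    induction l with
    | nil => exact fun h => Submodule.subset_span ⟨1, by simp [emptyWord]⟩
    | cons x l ih =>
      intro h
      rw [← letterOperator_single x l h]
      exact hstab x (ih _)
  rw [eq_top_iff, ← (Pi.basisFun ℚ (BoundedWord m v)).span_eq, Submodule.span_le]
  rintro _ ⟨l, rfl⟩
  rw [Pi.basisFun_apply]
  exact hword l.1 l.2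

end Magnus

/-! ### Independence of the eliminated elements. -/

section Independence

variable {m N r : ℕ} {z : Fin r → FreeGroup (Fin m)} {w : Fin r → ℕ}

/-- The free generators, with weight one. -/
def freeGenerators (m : ℕ) : Multiset (FreeGroup (Fin m) × ℕ) :=
  (Finset.univ : Finset (Fin m)).val.map fun x => (FreeGroup.of x, 1)

theorem HasElimination.exists_eq_orderedProd (h : HasElimination N (freeGenerators m) z w)
    (g : FreeGroup (Fin m)) :
    ∃ a : Fin r → ℤ, ∃ s ∈ gammaSubgroup (FreeGroup (Fin m)) N, g = orderedProd z a * s := by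
  refine h.exists_eq g ?_
  have : {x | ∃ v, (x, v) ∈ freeGenerators m} = Set.range (FreeGroup.of : Fin m → _) := by
    ext x
    simp [freeGenerators]
  rw [this, FreeGroup.closure_range_of]
  trivial

open PowerSeries in
theorem HasElimination.X_pow_dvd (h : HasElimination N (freeGenerators m) z w) :
    (X : ℚ⟦X⟧) ^ N ∣ ∏ j, (1 - (X : ℚ⟦X⟧) ^ w j) - (1 - (m : ℚ⟦X⟧) * X) := by
  have : ((freeGenerators m).map fun p => (X : ℚ⟦X⟧) ^ p.2).sum = (m : ℚ⟦X⟧) * X := by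
    rw [freeGenerators, Multiset.map_map]
    change ∑ _x : Fin m, (X : ℚ⟦X⟧) ^ 1 = _
    simp
  rw [← this]
  exact h.dvd_sub

/-- The operators `magnus z_j - 1`. -/
noncomputable def magnusSubOne (v : ℕ) (z : Fin r → FreeGroup (Fin m)) (j : Fin r) :
    Module.End ℚ (WordSpace m v) :=
  (magnus m v (z j) : Module.End ℚ (WordSpace m v)) - 1

theorem HasElimination.magnusSubOne_mem (h : HasElimination N (freeGenerators m) z w) (v : ℕ)
    (j : Fin r) : magnusSubOne v z j ∈ operatorFiltration m v (w j) :=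
  gammaSubgroup_le_magnusSubgroup (h.weight_pos j) (h.mem_gamma j)

theorem magnus_eq_one {v i : ℕ} (hv : v < i) {g : FreeGroup (Fin m)}
    (hg : g ∈ gammaSubgroup (FreeGroup (Fin m)) i) : magnus m v g = 1 := by
  have := eq_zero_of_mem_operatorFiltration
    (gammaSubgroup_le_magnusSubgroup (v := v) (by omega : 1 ≤ i) hg) hv
  exact Units.ext (sub_eq_zero.1 this)

theorem magnus_orderedProd (v : ℕ) (z : Fin r → FreeGroup (Fin m)) (a : Fin r → ℤ) :
    (magnus m v (orderedProd z a) : Module.End ℚ (WordSpace m v)) =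
      (List.ofFn fun j => ((magnus m v (z j) ^ a j : (Module.End ℚ (WordSpace m v))ˣ) :
        Module.End ℚ (WordSpace m v))).prod := by
  rw [orderedProd, map_list_prod, ← Units.coeHom_apply, map_list_prod, List.map_map,
    List.map_ofFn]
  congr 2
  funext j
  simp

/-- The ordered monomials in the `magnusSubOne v z j`, applied to the empty word. -/
noncomputable def magnusMonomial (v : ℕ) (z : Fin r → FreeGroup (Fin m)) (e : Fin r → ℕ) :
    WordSpace m v :=
  (List.ofFn fun j => magnusSubOne v z j ^ e j).prod (emptyWord m v)

theorem prod_ofFn_pow_mem {v n : ℕ} {P : Fin n → Module.End ℚ (WordSpace m v)} {u : Fin n → ℕ}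
    (h : ∀ j, P j ∈ operatorFiltration m v (u j)) (e : Fin n → ℕ) :
    (List.ofFn fun j => P j ^ e j).prod ∈ operatorFiltration m v (∑ j, e j * u j) := by
  induction n with
  | zero => simpa using one_mem_operatorFiltration
  | succ n ih =>
    rw [List.ofFn_succ, List.prod_cons, Fin.sum_univ_succ]
    exact mul_mem_operatorFiltration (pow_mem_operatorFiltration (h 0) _)
      (ih (fun j => h j.succ) fun j => e j.succ)

/-- Every `g` acts as an ordered product of powers `z_j^{a_j}`, each a polynomial in `z_j - 1`.
Expanding gives ordered monomials, and those of weight above `v` act as zero. -/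
theorem HasElimination.span_magnusMonomial (h : HasElimination N (freeGenerators m) z w) {v : ℕ}
    (hv : v < N) : ⊤ ≤ Submodule.span ℚ
      (Set.range fun e : boundedExponents w v => magnusMonomial v z e) := by
  rw [← span_magnus_emptyWord, Submodule.span_le]
  rintro _ ⟨g, rfl⟩
  obtain ⟨a, s, hs, rfl⟩ := h.exists_eq_orderedProd g
  simp only [map_mul, magnus_eq_one hv hs, mul_one, magnus_orderedProd]
  have hmem := prod_ofFn_mem_span (P := magnusSubOne v z) (T := fun j =>
    ((magnus m v (z j) ^ a j : (Module.End ℚ (WordSpace m v))ˣ) : Module.End ℚ (WordSpace m v)))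
    fun j => Units.zpow_mem_span_pow_of_isNilpotent _
      (isNilpotent_of_mem_operatorFiltration (h.magnusSubOne_mem v j) (h.weight_pos j)) _
  have hmap := Submodule.mem_map_of_mem (f := LinearMap.applyₗ (R := ℚ) (emptyWord m v)) hmem
  rw [Submodule.map_span] at hmap
  refine Submodule.span_le.2 ?_ hmap
  rintro _ ⟨_, ⟨e, rfl⟩, rfl⟩
  by_cases he : ∑ j, e j * w j ≤ v
  · exact Submodule.subset_span ⟨⟨e, (mem_boundedExponents h.weight_pos).2 he⟩, rfl⟩
  · have := eq_zero_of_mem_operatorFiltration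
      (prod_ofFn_pow_mem (h.magnusSubOne_mem v) e) (not_le.1 he)
    simp only [this, map_zero, SetLike.mem_coe, zero_mem]

/-- A spanning family with as many members as the dimension; both numbers are `1 + m + ⋯ + m^v`. -/
theorem HasElimination.linearIndependent_magnusMonomial
    (h : HasElimination N (freeGenerators m) z w) {v : ℕ} (hv : v < N) :
    LinearIndependent ℚ fun e : boundedExponents w v => magnusMonomial v z e := by
  refine linearIndependent_of_top_le_span_of_card_eq_finrank (h.span_magnusMonomial hv) ?_
  rw [Module.finrank_fintype_fun_eq_card, card_boundedWord, Fintype.card_coe,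
    card_boundedExponents h.weight_pos h.X_pow_dvd hv]

theorem HasElimination.linearIndependent_magnusSubOne
    (h : HasElimination N (freeGenerators m) z w) {v : ℕ} (hv : v < N) :
    LinearIndependent ℚ fun j : {j // w j = v} => magnusSubOne v z j := by
  let f : {j // w j = v} → boundedExponents w v := fun j =>
    ⟨Pi.single j.1 1, (mem_boundedExponents h.weight_pos).2 (by
      simp [Pi.single_apply, j.2])⟩
  have hf : Function.Injective f := by
    intro i j hij
    have := congrFun (congrArg Subtype.val hij) i.1
    simp only [f, Pi.single_eq_same, Pi.single_apply] at this
    by_contra hne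
    rw [if_neg fun h => hne (Subtype.ext h)] at this
    exact one_ne_zero this
  have hli := (h.linearIndependent_magnusMonomial hv).comp f hf
  refine LinearIndependent.of_comp (LinearMap.applyₗ (R := ℚ) (emptyWord m v)) ?_
  convert hli using 1
  funext j
  simp only [Function.comp_apply, f, magnusMonomial, prod_ofFn_pow_single]
  rfl

/-- Induction on the weight `v`, in the representation truncated at length `v`. Lighter factors have
exponent zero, heavier ones act trivially, and those of weight `v` multiply additively. So the
product acts as `1 + ∑ a_k (z_k - 1)` over weight `v`; it also acts as `1`, and the `z_k - 1` are
independent. -/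
theorem HasElimination.eq_zero_of_orderedProd_mem (h : HasElimination N (freeGenerators m) z w)
    {i : ℕ} (hi : i ≤ N) {a : Fin r → ℤ}
    (ha : orderedProd z a ∈ gammaSubgroup (FreeGroup (Fin m)) i) {j : Fin r} (hj : w j < i) :
    a j = 0 := by
  induction hv : w j using Nat.strong_induction_on generalizing j with
  | _ v ih =>
    let c : Fin r → ℚ := fun k => if w k = v then (a k : ℚ) else 0
    have hv1 : 1 ≤ v := hv ▸ h.weight_pos j
    have hvi : v < i := hv ▸ hj
    -- Such a product raises the filtration by at least `2v > v`.
    have hsq : ∀ k l, v ≤ w k → v ≤ w l → magnusSubOne v z k * magnusSubOne v z l = 0 :=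
      fun k l hk hl => eq_zero_of_mem_operatorFiltration
        (mul_mem_operatorFiltration (h.magnusSubOne_mem v k) (h.magnusSubOne_mem v l)) (by omega)
    have hfactor : ∀ k, ((magnus m v (z k) ^ a k : (Module.End ℚ (WordSpace m v))ˣ) :
        Module.End ℚ (WordSpace m v)) = 1 + c k • magnusSubOne v z k := by
      intro k
      have hk1 : (magnus m v (z k) : Module.End ℚ (WordSpace m v)) = 1 + magnusSubOne v z k :=
        (add_sub_cancel _ _).symm
      rcases lt_trichotomy (w k) v with hk | hk | hk
      · simp [c, hk.ne, ih (w k) hk (by omega : w k < i) rfl]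
      · simp only [c, hk, if_true]
        exact Units.zpow_eq_one_add_of_sq_eq_zero _ hk1 (hsq k k hk.ge hk.ge) _
      · have h0 := eq_zero_of_mem_operatorFiltration (h.magnusSubOne_mem v k) hk
        have : magnus m v (z k) = 1 := Units.ext (by rw [hk1, h0, add_zero]; rfl)
        simp [c, hk.ne', this]
    have hprod := magnus_orderedProd v z a
    simp only [magnus_eq_one hvi ha, hfactor] at hprod
    rw [prod_ofFn_one_add, Units.val_one, left_eq_add] at hprod
    · have hsum : ∑ k : {k // w k = v}, (a k : ℚ) • magnusSubOne v z k = 0 := by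
        rw [← hprod, ← Finset.sum_subtype (Finset.univ.filter fun k => w k = v) (by simp)
          fun k => (a k : ℚ) • magnusSubOne v z k, Finset.sum_filter]
        refine Finset.sum_congr rfl fun k _ => ?_
        by_cases hk : w k = v <;> simp [c, hk]
      have := Fintype.linearIndependent_iff.1
        (h.linearIndependent_magnusSubOne (hvi.trans_le hi)) _ hsum ⟨j, hv⟩
      exact_mod_cast this
    · intro k l
      simp only [c]
      split_ifs with hk hl
      · rw [smul_mul_smul_comm, hsq k l hk.ge hl.ge, smul_zero]
      all_goals simp

theorem exists_hasElimination_freeGenerators (m : ℕ) {N : ℕ} (hN : 1 ≤ N) :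
    ∃ (r : ℕ) (z : Fin r → FreeGroup (Fin m)) (w : Fin r → ℕ),
      HasElimination N (freeGenerators m) z w := by
  refine exists_hasElimination hN _ fun p hp => ?_
  obtain ⟨x, -, rfl⟩ := Multiset.mem_map.1 hp
  exact ⟨le_rfl, trivial⟩

end Independence

/-! ### Verbal and star subgroups of the outer commutator word. -/

section WordValues

variable {G : Type*} [Group G]

theorem wordValue_gammaWord_zero (s : ℕ) (f : ℕ → G) : wordValue (gammaWord s 0) f = f s := by
  simp [wordValue, gammaWord]

theorem wordValue_gammaWord_succ (s c : ℕ) (f : ℕ → G) : wordValue (gammaWord s (c + 1)) f =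
    ⁅wordValue (gammaWord s c) f, f (s + (c + 1))⁆ := by
  simp [wordValue, gammaWord, map_commutatorElement]

theorem wordValue_outerCommutatorWord (c₁ c₂ : ℕ) (f : ℕ → G) :
    wordValue (outerCommutatorWord c₁ c₂) f =
      ⁅wordValue (gammaWord 0 c₁) f, wordValue (gammaWord (c₁ + 1) c₂) f⁆ := by
  simp [wordValue, outerCommutatorWord, map_commutatorElement]

theorem wordValue_gammaWord_congr {s c : ℕ} {f f' : ℕ → G}
    (h : ∀ i, s ≤ i → i ≤ s + c → f i = f' i) :
    wordValue (gammaWord s c) f = wordValue (gammaWord s c) f' := by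
  induction c with
  | zero => rw [wordValue_gammaWord_zero, wordValue_gammaWord_zero, h s le_rfl (by omega)]
  | succ c ih =>
    rw [wordValue_gammaWord_succ, wordValue_gammaWord_succ, ih fun i h1 h2 => h i h1 (by omega),
      h _ (by omega) le_rfl]

theorem wordValue_gammaWord_eq_one {s : ℕ} (c : ℕ) {f : ℕ → G} (h : f s = 1) :
    wordValue (gammaWord s c) f = 1 := by
  induction c with
  | zero => rw [wordValue_gammaWord_zero, h]
  | succ c ih => rw [wordValue_gammaWord_succ, ih, commutatorElement_one_left]

/-- The values `[r, f₁, …, f_c]` with `r ∈ R`. -/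
def gammaValues (R : Set G) (s c : ℕ) : Set G :=
  {g | ∃ f : ℕ → G, f s ∈ R ∧ g = wordValue (gammaWord s c) f}

theorem gammaValues_zero (R : Set G) (s : ℕ) : gammaValues R s 0 = R := by
  ext g
  constructor
  · rintro ⟨f, hf, rfl⟩
    rwa [wordValue_gammaWord_zero]
  · exact fun hg => ⟨fun _ => g, hg, (wordValue_gammaWord_zero s fun _ => g).symm⟩

theorem gammaValues_succ (R : Set G) (s c : ℕ) :
    gammaValues R s (c + 1) = {g | ∃ y ∈ gammaValues R s c, ∃ x : G, g = ⁅y, x⁆} := by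
  ext g
  constructor
  · rintro ⟨f, hf, rfl⟩
    exact ⟨_, ⟨f, hf, rfl⟩, _, wordValue_gammaWord_succ _ _ _⟩
  · rintro ⟨_, ⟨f, hf, rfl⟩, x, rfl⟩
    refine ⟨Function.update f (s + (c + 1)) x, ?_, ?_⟩
    · rwa [Function.update_of_ne (by omega)]
    · rw [wordValue_gammaWord_succ, Function.update_self]
      congr 1
      exact wordValue_gammaWord_congr fun i _ h => (Function.update_of_ne (by omega) _ _).symm

theorem conj_mem_gammaValues {R : Subgroup G} [hR : R.Normal] {s c : ℕ} :
    ∀ y ∈ gammaValues (R : Set G) s c, ∀ g : G, g * y * g⁻¹ ∈ gammaValues (R : Set G) s c := by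
  rintro _ ⟨f, hf, rfl⟩ g
  exact ⟨fun j => g * f j * g⁻¹, hR.conj_mem _ hf g, map_wordValue (MulAut.conj g).toMonoidHom _ f⟩

theorem closure_gammaValues {k : ℕ} (hk : 1 ≤ k) (s c : ℕ) :
    Subgroup.closure (gammaValues (gammaSubgroup G k : Set G) s c) = gammaSubgroup G (k + c) := by
  induction c with
  | zero => rw [gammaValues_zero, Subgroup.closure_eq, add_zero]
  | succ c ih =>
    rw [gammaValues_succ, closure_commutator_top conj_mem_gammaValues, ih, ← add_assoc,
      gammaSubgroup_succ (by omega)]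

theorem wordValue_gammaWord_mem (s c : ℕ) (f : ℕ → G) :
    wordValue (gammaWord s c) f ∈ gammaSubgroup G (c + 1) := by
  rw [add_comm, ← closure_gammaValues le_rfl s c]
  exact Subgroup.subset_closure ⟨f, trivial, rfl⟩

theorem verbalSubgroup_gammaWord (c : ℕ) (G : Type*) [Group G] :
    verbalSubgroup {gammaWord 0 c} G = gammaSubgroup G (c + 1) := by
  rw [add_comm, ← closure_gammaValues le_rfl 0 c, verbalSubgroup]
  congr 1
  ext g
  constructor
  · rintro ⟨_, rfl, f, rfl⟩
    exact ⟨f, trivial, rfl⟩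
  · rintro ⟨f, -, rfl⟩
    exact ⟨_, rfl, f, rfl⟩

/-- The elements commuting with a given one modulo `N` form a subgroup; this is used in one argument
and then in the other. -/
theorem commutator_closure_le {S₁ S₂ : Set G} {N : Subgroup G} [N.Normal]
    (h : ∀ x ∈ S₁, ∀ y ∈ S₂, ⁅x, y⁆ ∈ N) :
    ⁅Subgroup.closure S₁, Subgroup.closure S₂⁆ ≤ N := by
  have hmk : ∀ x y : G, ⁅x, y⁆ ∈ N ↔ Commute (x : G ⧸ N) (y : G ⧸ N) := fun x y => by
    rw [← commutatorElement_eq_one_iff_commute, ← QuotientGroup.eq_one_iff]; rfl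
  have h1 : ∀ y ∈ S₂, Subgroup.closure S₁ ≤
      (Subgroup.centralizer {(y : G ⧸ N)}).comap (QuotientGroup.mk' N) := by
    intro y hy
    rw [Subgroup.closure_le]
    intro x hx
    exact Subgroup.mem_centralizer_singleton_iff.2 ((hmk x y).1 (h x hx y hy)).eq
  have h2 : ∀ x ∈ Subgroup.closure S₁, Subgroup.closure S₂ ≤
      (Subgroup.centralizer {(x : G ⧸ N)}).comap (QuotientGroup.mk' N) := by
    intro x hx
    rw [Subgroup.closure_le]
    intro y hy
    exact Subgroup.mem_centralizer_singleton_iff.2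
      (Subgroup.mem_centralizer_singleton_iff.1 (h1 y hy hx)).symm
  rw [Subgroup.commutator_le]
  intro x hx y hy
  exact (hmk x y).2 (Subgroup.mem_centralizer_singleton_iff.1 (h2 x hx hy)).symm

theorem commutatorElement_mul_mul_of_commute {g u h u' : G} (h1 : Commute u h)
    (h2 : Commute u u') (h3 : Commute g u') : ⁅g * u, h * u'⁆ = ⁅g, h⁆ := by
  have e : u * (h * u') * u⁻¹ = h * u' := by
    rw [(h1.mul_right h2).eq, mul_inv_cancel_right]
  have e' : u' * g⁻¹ * u'⁻¹ = g⁻¹ := by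
    rw [← h3.inv_left.eq, mul_inv_cancel_right]
  calc ⁅g * u, h * u'⁆ = g * (u * (h * u') * u⁻¹) * g⁻¹ * u'⁻¹ * h⁻¹ := by
        rw [commutatorElement_def]; group
    _ = g * h * (u' * g⁻¹ * u'⁻¹) * h⁻¹ := by rw [e]; group
    _ = ⁅g, h⁆ := by rw [e', commutatorElement_def]

theorem mk_commutatorElement_mul_mul {N : Subgroup G} [N.Normal] {g u h u' : G}
    (h1 : ⁅u, h⁆ ∈ N) (h2 : ⁅u, u'⁆ ∈ N) (h3 : ⁅g, u'⁆ ∈ N) :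
    ((⁅g * u, h * u'⁆ : G) : G ⧸ N) = (⁅g, h⁆ : G) := by
  have hmk : ∀ x y : G, ⁅x, y⁆ ∈ N → Commute (x : G ⧸ N) (y : G ⧸ N) := fun x y h => by
    rw [← commutatorElement_eq_one_iff_commute]; exact (QuotientGroup.eq_one_iff _).2 h
  exact commutatorElement_mul_mul_of_commute (hmk _ _ h1) (hmk _ _ h2) (hmk _ _ h3)

/-- Each further entry raises the depth of the error by one: the old error becomes central modulo
the next term, and the change of the new entry meets a commutator of weight `c + 1`. -/
theorem wordValue_gammaWord_modEq {k : ℕ} (hk : 1 ≤ k) (s c : ℕ) {f f' : ℕ → G}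
    (h : ∀ i, (f i)⁻¹ * f' i ∈ gammaSubgroup G k) :
    (wordValue (gammaWord s c) f)⁻¹ * wordValue (gammaWord s c) f' ∈ gammaSubgroup G (k + c) := by
  induction c with
  | zero => simpa only [wordValue_gammaWord_zero, add_zero] using h s
  | succ c ih =>
    rw [wordValue_gammaWord_succ, wordValue_gammaWord_succ, ← QuotientGroup.eq]
    rw [show wordValue (gammaWord s c) f' = wordValue (gammaWord s c) f *
      ((wordValue (gammaWord s c) f)⁻¹ * wordValue (gammaWord s c) f') by group,
      show f' (s + (c + 1)) = f (s + (c + 1)) * ((f (s + (c + 1)))⁻¹ * f' (s + (c + 1))) by group]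
    have hcentral : ∀ y : G, ⁅(wordValue (gammaWord s c) f)⁻¹ * wordValue (gammaWord s c) f', y⁆ ∈
        gammaSubgroup G (k + (c + 1)) := fun y => by
      rw [← add_assoc, gammaSubgroup_succ (by omega)]
      exact Subgroup.commutator_mem_commutator ih trivial
    refine (mk_commutatorElement_mul_mul (hcentral _) (hcentral _) ?_).symm
    rw [add_comm]
    exact commutatorElement_mem_gammaSubgroup (wordValue_gammaWord_mem s c f) (h _)

/-- A sequence agreeing with `f₁` up to `c` and with `f₂` from `c + 1` on. -/
def glue (c : ℕ) (f₁ f₂ : ℕ → G) (i : ℕ) : G := if i ≤ c then f₁ i else f₂ i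

theorem wordValue_glue_left (c : ℕ) (f₁ f₂ : ℕ → G) :
    wordValue (gammaWord 0 c) (glue c f₁ f₂) = wordValue (gammaWord 0 c) f₁ :=
  wordValue_gammaWord_congr fun i _ h => if_pos (by omega)

theorem wordValue_glue_right (c c' : ℕ) (f₁ f₂ : ℕ → G) :
    wordValue (gammaWord (c + 1) c') (glue c f₁ f₂) = wordValue (gammaWord (c + 1) c') f₂ :=
  wordValue_gammaWord_congr fun i h _ => if_neg (by omega)

theorem verbalSubgroup_outerCommutatorWord (c₁ c₂ : ℕ) (G : Type*) [Group G] :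
    verbalSubgroup {outerCommutatorWord c₁ c₂} G =
      ⁅gammaSubgroup G (c₁ + 1), gammaSubgroup G (c₂ + 1)⁆ := by
  apply le_antisymm
  · rw [verbalSubgroup, Subgroup.closure_le]
    rintro _ ⟨_, rfl, f, rfl⟩
    rw [wordValue_outerCommutatorWord]
    exact Subgroup.commutator_mem_commutator (wordValue_gammaWord_mem _ _ _)
      (wordValue_gammaWord_mem _ _ _)
  · rw [add_comm c₁, add_comm c₂, ← closure_gammaValues le_rfl 0 c₁,
      ← closure_gammaValues le_rfl (c₁ + 1) c₂]
    refine commutator_closure_le ?_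
    rintro _ ⟨f₁, -, rfl⟩ _ ⟨f₂, -, rfl⟩
    refine Subgroup.subset_closure ⟨_, rfl, glue c₁ f₁ f₂, ?_⟩
    rw [wordValue_outerCommutatorWord, wordValue_glue_left, wordValue_glue_right]

/-- Changing an argument by `r ∈ γ_{n+1}` multiplies the inner values by errors in `γ_{n+1+c₁}` and
`γ_{n+1+c₂}`, and all mixed commutators with these errors lie in the right-hand side. Conversely, a
generator whose unperturbed value is trivial is itself a commutator of the required kind. -/
theorem starSubgroup_outerCommutatorWord (c₁ c₂ n : ℕ) (G : Type*) [Group G] :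
    starSubgroup {outerCommutatorWord c₁ c₂} (gammaSubgroup G (n + 1)) =
      ⁅gammaSubgroup G (n + 1 + c₁), gammaSubgroup G (c₂ + 1)⁆ ⊔
        ⁅gammaSubgroup G (c₁ + 1), gammaSubgroup G (n + 1 + c₂)⁆ := by
  apply le_antisymm
  · set D := ⁅gammaSubgroup G (n + 1 + c₁), gammaSubgroup G (c₂ + 1)⁆ ⊔
        ⁅gammaSubgroup G (c₁ + 1), gammaSubgroup G (n + 1 + c₂)⁆ with hD
    rw [starSubgroup, Subgroup.closure_le]
    rintro _ ⟨_, rfl, f, i, r, hr, rfl⟩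
    have hf : ∀ j, (f j)⁻¹ * Function.update f i (f i * r) j ∈ gammaSubgroup G (n + 1) := by
      intro j
      by_cases hj : j = i
      · subst hj; simpa using hr
      · simp [hj]
    have h1 := wordValue_gammaWord_modEq (by omega) 0 c₁ hf
    have h2 := wordValue_gammaWord_modEq (by omega) (c₁ + 1) c₂ hf
    have hle1 : ⁅gammaSubgroup G (n + 1 + c₁), gammaSubgroup G (c₂ + 1)⁆ ≤ D := le_sup_left
    have hle2 : ⁅gammaSubgroup G (c₁ + 1), gammaSubgroup G (n + 1 + c₂)⁆ ≤ D := le_sup_right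
    have key := mk_commutatorElement_mul_mul (N := D)
      (g := wordValue (gammaWord 0 c₁) f) (h := wordValue (gammaWord (c₁ + 1) c₂) f)
      (hle1 (Subgroup.commutator_mem_commutator h1 (wordValue_gammaWord_mem _ _ _)))
      (hle1 (Subgroup.commutator_mem_commutator h1
        (gammaSubgroup_antitone (by omega) h2)))
      (hle2 (Subgroup.commutator_mem_commutator (wordValue_gammaWord_mem _ _ _) h2))
    rw [mul_inv_cancel_left, mul_inv_cancel_left, ← wordValue_outerCommutatorWord,
      ← wordValue_outerCommutatorWord, ← div_eq_one, ← QuotientGroup.mk_div,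
      QuotientGroup.eq_one_iff, div_eq_mul_inv] at key
    exact key
  · refine sup_le ?_ ?_
    · rw [← closure_gammaValues (by omega) 0 c₁, add_comm c₂,
        ← closure_gammaValues le_rfl (c₁ + 1) c₂]
      refine commutator_closure_le ?_
      rintro _ ⟨f₁, hf₁, rfl⟩ _ ⟨f₂, -, rfl⟩
      -- The first entry is `1` and `r = f₁ 0` restores it, so the unperturbed word value is
      -- trivial.
      refine Subgroup.subset_closure ⟨_, rfl, Function.update (glue c₁ f₁ f₂) 0 1, 0, f₁ 0, hf₁, ?_⟩
      have : Function.update (Function.update (glue c₁ f₁ f₂) 0 1) 0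
          (Function.update (glue c₁ f₁ f₂) 0 1 0 * f₁ 0) = glue c₁ f₁ f₂ := by
        rw [Function.update_self, one_mul, Function.update_idem, Function.update_eq_self_iff]
        exact (if_pos (Nat.zero_le _)).symm
      rw [this, wordValue_outerCommutatorWord, wordValue_outerCommutatorWord,
        wordValue_gammaWord_eq_one (s := 0) c₁ (f := Function.update (glue c₁ f₁ f₂) 0 1) (Function.update_self _ _ _),
        commutatorElement_one_left, inv_one, mul_one, wordValue_glue_left, wordValue_glue_right]
    · rw [← closure_gammaValues (by omega) (c₁ + 1) c₂, add_comm c₁,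
        ← closure_gammaValues le_rfl 0 c₁, add_comm 1 c₁]
      refine commutator_closure_le ?_
      rintro _ ⟨f₁, -, rfl⟩ _ ⟨f₂, hf₂, rfl⟩
      refine Subgroup.subset_closure ⟨_, rfl, Function.update (glue c₁ f₁ f₂) (c₁ + 1) 1, c₁ + 1,
        f₂ (c₁ + 1), hf₂, ?_⟩
      have : Function.update (Function.update (glue c₁ f₁ f₂) (c₁ + 1) 1) (c₁ + 1)
          (Function.update (glue c₁ f₁ f₂) (c₁ + 1) 1 (c₁ + 1) * f₂ (c₁ + 1)) =
            glue c₁ f₁ f₂ := by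
        rw [Function.update_self, one_mul, Function.update_idem, Function.update_eq_self_iff]
        exact (if_neg (by omega)).symm
      rw [this, wordValue_outerCommutatorWord, wordValue_outerCommutatorWord,
        wordValue_gammaWord_eq_one (s := c₁ + 1) c₂ (f := Function.update (glue c₁ f₁ f₂) (c₁ + 1) 1)
          (Function.update_self _ _ _),
        commutatorElement_one_right, inv_one, mul_one, wordValue_glue_left, wordValue_glue_right]

end WordValues

/-! ### Ordered products. -/

section OrderedProd

theorem map_orderedProd {G H : Type*} [Group G] [Group H] (φ : G →* H) {r : ℕ} (z : Fin r → G)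
    (a : Fin r → ℤ) : φ (orderedProd z a) = orderedProd (fun j => φ (z j)) a := by
  rw [orderedProd, map_list_prod, List.map_ofFn, orderedProd]
  congr 2
  funext j
  simp

variable {G : Type*} [Group G]

theorem orderedProd_succ {r : ℕ} (z : Fin (r + 1) → G) (a : Fin (r + 1) → ℤ) :
    orderedProd z a = z 0 ^ a 0 * orderedProd (fun j => z j.succ) fun j => a j.succ := by
  simp [orderedProd, List.ofFn_succ]

theorem orderedProd_zero {r : ℕ} (z : Fin r → G) : orderedProd z 0 = 1 := by
  induction r with
  | zero => simp [orderedProd]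
  | succ r ih =>
    rw [orderedProd_succ, Pi.zero_apply, zpow_zero, one_mul]
    exact ih _

theorem orderedProd_mem {r : ℕ} {z : Fin r → G} {a : Fin r → ℤ} {H : Subgroup G}
    (h : ∀ j, z j ^ a j ∈ H) : orderedProd z a ∈ H :=
  list_prod_mem fun x hx => by
    obtain ⟨j, rfl⟩ := (List.mem_ofFn' _ _).1 hx
    exact h j

theorem orderedProd_single {r : ℕ} (z : Fin r → G) (j : Fin r) :
    orderedProd z (Pi.single j 1) = z j := by
  induction r with
  | zero => exact j.elim0
  | succ r ih =>
    rw [orderedProd_succ]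
    cases j using Fin.cases with
    | zero =>
      have : (fun i : Fin r => (Pi.single 0 1 : Fin (r + 1) → ℤ) i.succ) = 0 := by
        funext i; simp
      rw [this, orderedProd_zero, Pi.single_eq_same, zpow_one, mul_one]
    | succ j =>
      have : (fun i : Fin r => (Pi.single j.succ 1 : Fin (r + 1) → ℤ) i.succ) = Pi.single j 1 := by
        funext i; simp [Pi.single_apply]
      rw [this, ih, Pi.single_eq_of_ne (Fin.succ_ne_zero j).symm, zpow_zero, one_mul]

theorem orderedProd_add {r : ℕ} {z : Fin r → G} {a a' : Fin r → ℤ}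
    (h : ∀ i j, Commute (z i ^ a' i) (z j ^ a j)) :
    orderedProd z (a + a') = orderedProd z a * orderedProd z a' := by
  induction r with
  | zero => simp [orderedProd]
  | succ r ih =>
    have h1 : Commute (z 0 ^ a' 0) (orderedProd (fun j => z j.succ) fun j => a j.succ) :=
      Commute.list_prod_right _ _ fun x hx => by
        obtain ⟨j, rfl⟩ := (List.mem_ofFn' _ _).1 hx
        exact h 0 j.succ
    have h2 := ih (z := fun j => z j.succ) (a := fun j => a j.succ) (a' := fun j => a' j.succ)
      fun i j => h i.succ j.succ
    rw [orderedProd_succ, orderedProd_succ z a, orderedProd_succ z a', Pi.add_apply, zpow_add]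
    change _ * orderedProd (fun j => z j.succ) ((fun j => a j.succ) + fun j => a' j.succ) = _
    rw [h2, mul_assoc, mul_assoc, ← mul_assoc (z 0 ^ a' 0), h1.eq]
    simp only [mul_assoc]

end OrderedProd

/-! ### The Heisenberg group and cocycles on free groups. -/

section Heisenberg

/-- The integral Heisenberg group, as triples with multiplication
`(x, y, t) (x', y', t') = (x + x', y + y', t + t' + x y')`. -/
@[ext]
structure HeisenbergGroup where
  x : ℤ
  y : ℤ
  t : ℤ

namespace HeisenbergGroup

instance : Mul HeisenbergGroup := ⟨fun g h => ⟨g.x + h.x, g.y + h.y, g.t + h.t + g.x * h.y⟩⟩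
instance : One HeisenbergGroup := ⟨⟨0, 0, 0⟩⟩
instance : Inv HeisenbergGroup := ⟨fun g => ⟨-g.x, -g.y, -g.t + g.x * g.y⟩⟩

theorem mul_def (g h : HeisenbergGroup) :
    g * h = ⟨g.x + h.x, g.y + h.y, g.t + h.t + g.x * h.y⟩ := rfl

theorem one_def : (1 : HeisenbergGroup) = ⟨0, 0, 0⟩ := rfl

theorem inv_def (g : HeisenbergGroup) : g⁻¹ = ⟨-g.x, -g.y, -g.t + g.x * g.y⟩ := rfl

instance : Group HeisenbergGroup := Group.ofLeftAxioms
  (fun g h k => by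
    simp only [mul_def, HeisenbergGroup.mk.injEq]
    exact ⟨by ring, by ring, by ring⟩)
  (fun g => by simp [mul_def, one_def])
  (fun g => by simp [mul_def, inv_def, one_def])

/-- The projection to the first coordinate. -/
def xHom : HeisenbergGroup →* Multiplicative ℤ where
  toFun g := Multiplicative.ofAdd g.x
  map_one' := rfl
  map_mul' _ _ := rfl

/-- The projection to the second coordinate. -/
def yHom : HeisenbergGroup →* Multiplicative ℤ where
  toFun g := Multiplicative.ofAdd g.y
  map_one' := rfl
  map_mul' _ _ := rfl

end HeisenbergGroup

/-- On a free group the cocycle `α(g) β(h)` is a coboundary. -/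
theorem exists_cochain_of_isFreeGroup {K : Type*} [Group K] [IsFreeGroup K]
    (α β : K →* Multiplicative ℤ) : ∃ l : K → ℤ, ∀ g h,
      l (g * h) = l g + l h + (α g).toAdd * (β h).toAdd := by
  -- Lift `(α, β)` to the Heisenberg group, with any third coordinate on the generators. The third
  -- coordinate of the lift is the cochain, by the multiplication rule.
  let θ : K →* HeisenbergGroup := IsFreeGroup.lift fun s =>
    ⟨(α (IsFreeGroup.of s)).toAdd, (β (IsFreeGroup.of s)).toAdd, 0⟩
  have hα : HeisenbergGroup.xHom.comp θ = α := IsFreeGroup.ext_hom fun s => by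
    simp [θ, HeisenbergGroup.xHom]
  have hβ : HeisenbergGroup.yHom.comp θ = β := IsFreeGroup.ext_hom fun s => by
    simp [θ, HeisenbergGroup.yHom]
  refine ⟨fun g => (θ g).t, fun g h => ?_⟩
  rw [← hα, ← hβ]
  simp only [map_mul]
  rfl

end Heisenberg

/-! ### Coordinates on the lower central series and the pairing. -/

section Coordinates

variable {m N b r : ℕ} {z : Fin r → FreeGroup (Fin m)} {w : Fin r → ℕ}

theorem HasElimination.gammaSubgroup_le (h : HasElimination N (freeGenerators m) z w) {i : ℕ}
    (hi : i ≤ N) {H : Subgroup (FreeGroup (Fin m))} (hz : ∀ j, i ≤ w j → z j ∈ H)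
    (hN : gammaSubgroup (FreeGroup (Fin m)) N ≤ H) :
    gammaSubgroup (FreeGroup (Fin m)) i ≤ H := by
  intro g hg
  obtain ⟨a, s, hs, rfl⟩ := h.exists_eq_orderedProd g
  refine mul_mem (orderedProd_mem fun j => ?_) (hN hs)
  rcases lt_or_ge (w j) i with hj | hj
  · rw [h.eq_zero_of_orderedProd_mem hi ((Subgroup.mul_mem_cancel_right _
      (gammaSubgroup_antitone hi hs)).1 hg) hj, zpow_zero]
    exact one_mem _
  · exact H.zpow_mem (hz j hj) _

/-- The exponents of an element in terms of an elimination. -/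
noncomputable def HasElimination.coord (h : HasElimination N (freeGenerators m) z w)
    (g : FreeGroup (Fin m)) : Fin r → ℤ :=
  (h.exists_eq_orderedProd g).choose

theorem HasElimination.exists_eq_coord (h : HasElimination N (freeGenerators m) z w)
    (g : FreeGroup (Fin m)) :
    ∃ s ∈ gammaSubgroup (FreeGroup (Fin m)) N, g = orderedProd z (h.coord g) * s :=
  (h.exists_eq_orderedProd g).choose_spec

theorem HasElimination.coord_eq_zero (h : HasElimination N (freeGenerators m) z w) {i : ℕ}
    (hi : i ≤ N) {g : FreeGroup (Fin m)} (hg : g ∈ gammaSubgroup (FreeGroup (Fin m)) i)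
    {j : Fin r} (hj : w j < i) : h.coord g j = 0 := by
  obtain ⟨s, hs, hgs⟩ := h.exists_eq_coord g
  refine h.eq_zero_of_orderedProd_mem hi ?_ hj
  rw [hgs] at hg
  exact (Subgroup.mul_mem_cancel_right _ (gammaSubgroup_antitone hi hs)).1 hg

theorem HasElimination.mk_orderedProd_coord (h : HasElimination N (freeGenerators m) z w)
    (g : FreeGroup (Fin m)) : ((orderedProd z (h.coord g) : FreeGroup (Fin m)) :
      FreeGroup (Fin m) ⧸ gammaSubgroup (FreeGroup (Fin m)) N) = g := by
  obtain ⟨s, hs, hgs⟩ := h.exists_eq_coord g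
  rw [QuotientGroup.eq]
  nth_rw 2 [hgs]
  rwa [inv_mul_cancel_left]

/-- Only factors from `γ_b` occur, and these commute modulo `γ_N` because `[γ_b, γ_b] ≤ γ_{2b} ≤
γ_N`. -/
theorem HasElimination.mk_orderedProd_add (h : HasElimination N (freeGenerators m) z w)
    (hb : N ≤ 2 * b) {a a' : Fin r → ℤ} (ha : ∀ j, w j < b → a j = 0)
    (ha' : ∀ j, w j < b → a' j = 0) :
    ((orderedProd z (a + a') : FreeGroup (Fin m)) : FreeGroup (Fin m) ⧸ gammaSubgroup (FreeGroup (Fin m)) N) =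
      (orderedProd z a : FreeGroup (Fin m)) * (orderedProd z a' : FreeGroup (Fin m)) := by
  have hmk : ∀ c : Fin r → ℤ,
      ((orderedProd z c : FreeGroup (Fin m)) : FreeGroup (Fin m) ⧸ gammaSubgroup (FreeGroup (Fin m)) N) =
        orderedProd (fun j => (z j : FreeGroup (Fin m) ⧸ gammaSubgroup (FreeGroup (Fin m)) N)) c :=
    fun c => map_orderedProd (QuotientGroup.mk' _) z c
  rw [hmk, hmk, hmk]
  refine orderedProd_add fun i j => ?_
  by_cases hi : w i < b
  · rw [ha' i hi, zpow_zero]; exact Commute.one_left _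
  by_cases hj : w j < b
  · rw [ha j hj, zpow_zero]; exact Commute.one_right _
  refine (commute_mk_of_commutator_le ((commutator_gammaSubgroup_le b b).trans
    (gammaSubgroup_antitone (by omega)))
    (gammaSubgroup_antitone (not_lt.1 hi) (h.mem_gamma i))
    (gammaSubgroup_antitone (not_lt.1 hj) (h.mem_gamma j))).zpow_zpow _ _

theorem HasElimination.coord_unique (h : HasElimination N (freeGenerators m) z w)
    (hb : N ≤ 2 * b) (hbN : b ≤ N) {g : FreeGroup (Fin m)}
    (hg : g ∈ gammaSubgroup (FreeGroup (Fin m)) b) {a : Fin r → ℤ}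
    (ha : ∀ j, w j < b → a j = 0)
    (h1 : ((orderedProd z a : FreeGroup (Fin m)) : FreeGroup (Fin m) ⧸ gammaSubgroup (FreeGroup (Fin m)) N) = g) :
    h.coord g = a := by
  have h2 := h.mk_orderedProd_coord g
  have hsub : ∀ j, w j < b → (h.coord g - a) j = 0 := fun j hj => by
    rw [Pi.sub_apply, ha j hj, h.coord_eq_zero hbN hg hj, sub_zero]
  have h3 := h.mk_orderedProd_add hb hsub ha
  rw [sub_add_cancel, h1, h2, eq_comm, mul_eq_right, QuotientGroup.eq_one_iff] at h3
  funext j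
  exact sub_eq_zero.1 (h.eq_zero_of_orderedProd_mem le_rfl h3 (h.weight_lt j))

theorem HasElimination.coord_mul (h : HasElimination N (freeGenerators m) z w)
    (hb : N ≤ 2 * b) (hbN : b ≤ N) {g g' : FreeGroup (Fin m)}
    (hg : g ∈ gammaSubgroup (FreeGroup (Fin m)) b)
    (hg' : g' ∈ gammaSubgroup (FreeGroup (Fin m)) b) :
    h.coord (g * g') = h.coord g + h.coord g' := by
  have h1 : ∀ j, w j < b → h.coord g j = 0 := fun j hj => h.coord_eq_zero hbN hg hj
  have h2 : ∀ j, w j < b → h.coord g' j = 0 := fun j hj => h.coord_eq_zero hbN hg' hj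
  refine h.coord_unique hb hbN (mul_mem hg hg') (fun j hj => ?_) ?_
  · rw [Pi.add_apply, h1 j hj, h2 j hj, add_zero]
  · rw [h.mk_orderedProd_add hb h1 h2, h.mk_orderedProd_coord, h.mk_orderedProd_coord,
      QuotientGroup.mk_mul]

theorem HasElimination.coord_apply (h : HasElimination N (freeGenerators m) z w)
    (hb : N ≤ 2 * b) (hbN : b ≤ N) {k : Fin r} (hk : b ≤ w k) :
    h.coord (z k) = Pi.single k 1 := by
  refine h.coord_unique hb hbN (gammaSubgroup_antitone hk (h.mem_gamma k)) (fun j hj => ?_) ?_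
  · rw [Pi.single_eq_of_ne]
    rintro rfl
    omega
  · rw [orderedProd_single]

/-- The coordinates are homomorphisms on `γ_b` if `N ≤ 2 b`. -/
noncomputable def HasElimination.coordHom (h : HasElimination N (freeGenerators m) z w)
    (hb : N ≤ 2 * b) (hbN : b ≤ N) (j : Fin r) :
    gammaSubgroup (FreeGroup (Fin m)) b →* Multiplicative ℤ :=
  MonoidHom.mk' (fun g => Multiplicative.ofAdd (h.coord g j)) fun g g' => by
    rw [Subgroup.coe_mul, h.coord_mul hb hbN g.2 g'.2]; rfl

/-- `γ_b` is free by Nielsen–Schreier, so a cochain `l` with coboundary `α(g) β(h)` exists for the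
coordinates `α`, `β` of indices `j`, `k`. All coordinates vanish on `γ_N`, so `l` is a homomorphism
there. This functional detects commutators that the coordinates themselves cannot see. -/
theorem HasElimination.exists_pairing (h : HasElimination N (freeGenerators m) z w)
    (hb : N ≤ 2 * b) (hbN : b ≤ N) (j k : Fin r) :
    ∃ l : gammaSubgroup (FreeGroup (Fin m)) N →* Multiplicative ℤ,
      ∀ x ∈ gammaSubgroup (FreeGroup (Fin m)) b, ∀ y ∈ gammaSubgroup (FreeGroup (Fin m)) b,
      ∀ hxy : ⁅x, y⁆ ∈ gammaSubgroup (FreeGroup (Fin m)) N, l ⟨⁅x, y⁆, hxy⟩ =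
        Multiplicative.ofAdd (h.coord x j * h.coord y k - h.coord y j * h.coord x k) := by
  obtain ⟨l, hl⟩ := exists_cochain_of_isFreeGroup (h.coordHom hb hbN j) (h.coordHom hb hbN k)
  have hl' : ∀ x y : gammaSubgroup (FreeGroup (Fin m)) b,
      l (x * y) = l x + l y + h.coord x j * h.coord y k := hl
  let ι : gammaSubgroup (FreeGroup (Fin m)) N →* gammaSubgroup (FreeGroup (Fin m)) b :=
    Subgroup.inclusion (gammaSubgroup_antitone hbN)
  have hι : ∀ (g : gammaSubgroup (FreeGroup (Fin m)) N) i, h.coord (ι g) i = 0 := fun g i =>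
    h.coord_eq_zero le_rfl g.2 (h.weight_lt i)
  refine ⟨MonoidHom.mk' (fun g => Multiplicative.ofAdd (l (ι g))) fun g g' => ?_, ?_⟩
  · rw [map_mul, hl', hι, zero_mul, add_zero]; rfl
  · intro x hx y hy hxy
    rw [MonoidHom.mk'_apply]
    congr 1
    -- Evaluate `l` on both sides of `⁅x, y⁆ (y x) = x y`; no cross term arises from `⁅x, y⁆`, so
    -- the difference of the two cocycle values remains.
    have e : ι ⟨⁅x, y⁆, hxy⟩ * ((⟨y, hy⟩ : gammaSubgroup (FreeGroup (Fin m)) b) * ⟨x, hx⟩) =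
        ⟨x, hx⟩ * ⟨y, hy⟩ := by
      apply Subtype.ext
      change ⁅x, y⁆ * (y * x) = x * y
      rw [commutatorElement_def]; group
    have := congrArg l e
    rw [hl', hι, hl', hl'] at this
    simp only at this
    linarith

end Coordinates

/-! ### A criterion for being free abelian. -/

section FreeAbelian

/-- A generating family of an abelian group with a dual family of functionals is a basis. -/
theorem nonempty_mulEquiv_of_dual {A S : Type*} [Group A] [Fintype S] [DecidableEq S]
    (hcomm : ∀ x y : A, x * y = y * x) (c : S → A) (hc : Subgroup.closure (Set.range c) = ⊤)
    (l : A →* Multiplicative (S → ℤ))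
    (hl : ∀ s, l (c s) = Multiplicative.ofAdd (Pi.single s 1)) :
    Nonempty (A ≃* Multiplicative (Fin (Fintype.card S) → ℤ)) := by
  let _ : CommGroup A := { (inferInstance : Group A) with mul_comm := hcomm }
  have hprod : ∀ n : S → ℤ, l (∏ s, c s ^ n s) = Multiplicative.ofAdd n := by
    intro n
    rw [map_prod]
    simp only [map_zpow, hl, ← ofAdd_zsmul]
    rw [← ofAdd_sum]
    congr 1
    funext t
    simp [Finset.sum_apply, Pi.single_apply]
  have hex : ∀ x : A, ∃ n : S → ℤ, x = ∏ s, c s ^ n s := fun x =>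
    Subgroup.mem_closure_range_iff_of_fintype.1 (hc ▸ Subgroup.mem_top x)
  have hbij : Function.Bijective l := by
    constructor
    · rw [injective_iff_map_eq_one]
      intro x hx
      obtain ⟨n, rfl⟩ := hex x
      rw [hprod] at hx
      have hn : n = 0 := hx
      simp [hn]
    · exact fun n => ⟨_, hprod n.toAdd⟩
  exact ⟨(MulEquiv.ofBijective l hbij).trans (AddEquiv.toMultiplicative
    (LinearEquiv.funCongrLeft ℤ ℤ (Fintype.equivFin S).symm).toAddEquiv)⟩

end FreeAbelian

/-! ### Additivity of commutators modulo a normal subgroup. -/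

section CommutatorQuotient

variable {G : Type*} [Group G]

/-- The elements of `Q` whose commutator with `x` lies in `U`. -/
def commutatorSlice (Q : Subgroup G) {D U : Subgroup G} [D.Normal] (hDU : D ≤ U) (x : G)
    (h : ∀ y ∈ Q, ∀ y' ∈ Q, ⁅y, ⁅x, y'⁆⁆ ∈ D) : Subgroup G where
  carrier := {y | y ∈ Q ∧ ⁅x, y⁆ ∈ U}
  one_mem' := ⟨one_mem Q, by simp⟩
  mul_mem' := by
    rintro y y' ⟨hy, hy1⟩ ⟨hy', hy1'⟩
    refine ⟨mul_mem hy hy', ?_⟩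
    have e : ⁅x, y * y'⁆ = ⁅x, y⁆ * (⁅y, ⁅x, y'⁆⁆ * ⁅x, y'⁆) := by
      simp only [commutatorElement_def]; group
    rw [e]
    exact mul_mem hy1 (mul_mem (hDU (h y hy y' hy')) hy1')
  inv_mem' := by
    rintro y ⟨hy, hy1⟩
    refine ⟨inv_mem hy, ?_⟩
    have e : ⁅x, y⁻¹⁆ = (⁅x, y⁆ * ⁅⁅x, y⁆⁻¹, y⁻¹⁆)⁻¹ := by
      simp only [commutatorElement_def]; group
    have e' : ⁅⁅x, y⁆⁻¹, y⁻¹⁆ = (⁅x, y⁆⁻¹ * y⁻¹) * ⁅y, ⁅x, y⁆⁆⁻¹ * (⁅x, y⁆⁻¹ * y⁻¹)⁻¹ := by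
      simp only [commutatorElement_def]; group
    rw [e, e']
    exact inv_mem (mul_mem hy1 
      (hDU (Subgroup.Normal.conj_mem inferInstance _ (inv_mem (h y hy y hy)) _)))

theorem mem_of_le_commutatorSlice {P Q D U : Subgroup G} [D.Normal] {hDU : D ≤ U} {x : G}
    {h : ∀ y ∈ Q, ∀ y' ∈ Q, ⁅y, ⁅x, y'⁆⁆ ∈ D} (hle : P ≤ commutatorSlice Q hDU x h) {y : G}
    (hy : y ∈ P) : ⁅x, y⁆ ∈ U :=
  (hle hy).2

theorem commutatorElement_mem_comm {U : Subgroup G} {x y : G} (h : ⁅x, y⁆ ∈ U) : ⁅y, x⁆ ∈ U := by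
  rw [← commutatorElement_inv]; exact inv_mem h

end CommutatorQuotient

/-! ### The quotient of `[γ_a, γ_b]` is free abelian on `basisPairs`. -/

section Structure

variable {m n a b r : ℕ} {z : Fin r → FreeGroup (Fin m)} {w : Fin r → ℕ}

/-- The index pairs `(j, k)` of a basis `⁅z_j, z_k⁆` of
`⁅γ_a, γ_b⁆ / (⁅γ_{a+n}, γ_b⁆ ⊔ ⁅γ_a, γ_{b+n}⁆)`. -/
def basisPairs (w : Fin r → ℕ) (a b n : ℕ) : Finset (Fin r × Fin r) :=
  Finset.univ.filter fun p => a ≤ w p.1 ∧ b ≤ w p.2 ∧ w p.2 < b + n ∧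
    (w p.2 < a ∨ (w p.1 < b + n ∧ p.1 < p.2))

theorem mem_basisPairs {p : Fin r × Fin r} : p ∈ basisPairs w a b n ↔
    a ≤ w p.1 ∧ b ≤ w p.2 ∧ w p.2 < b + n ∧ (w p.2 < a ∨ (w p.1 < b + n ∧ p.1 < p.2)) := by
  simp [basisPairs]

/-- Commutators are bilinear modulo `D`, so pairs of the `z_j` suffice. If `w k < a`, the pair has
no admissible reversal. If `w k ≥ a`, both orders occur up to inversion, so `j < k` may be required,
and `w j ≥ b + n` puts the reversed commutator into `D`. -/
theorem HasElimination.commutator_le_closure_sup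
    (h : HasElimination (a + n) (freeGenerators m) z w) (hab : b ≤ a) (hb : a + n ≤ 2 * b)
    {D : Subgroup (FreeGroup (Fin m))} [D.Normal]
    (hD₁ : ⁅gammaSubgroup (FreeGroup (Fin m)) (a + n), gammaSubgroup (FreeGroup (Fin m)) b⁆ ≤ D)
    (hD₂ : ⁅gammaSubgroup (FreeGroup (Fin m)) a, gammaSubgroup (FreeGroup (Fin m)) (b + n)⁆ ≤ D) :
    ⁅gammaSubgroup (FreeGroup (Fin m)) a, gammaSubgroup (FreeGroup (Fin m)) b⁆ ≤
      Subgroup.closure (Set.range fun p : basisPairs w a b n => ⁅z p.1.1, z p.1.2⁆) ⊔ D := by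
  set U := Subgroup.closure (Set.range fun p : basisPairs w a b n => ⁅z p.1.1, z p.1.2⁆) ⊔ D
  have hDU : D ≤ U := le_sup_right
  have hS : ∀ j k, (j, k) ∈ basisPairs w a b n → ⁅z j, z k⁆ ∈ U := fun j k hjk =>
    (le_sup_left : _ ≤ U) (Subgroup.subset_closure ⟨⟨_, hjk⟩, rfl⟩)
  have hpair : ∀ j k, a ≤ w j → b ≤ w k → ⁅z j, z k⁆ ∈ U := by
    intro j k hj hk
    by_cases hk2 : w k < b + n
    · by_cases hka : w k < a
      · exact hS j k (mem_basisPairs.2 ⟨hj, hk, hk2, Or.inl hka⟩)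
      · by_cases hj2 : w j < b + n
        · rcases lt_trichotomy j k with hjk | rfl | hjk
          · exact hS j k (mem_basisPairs.2 ⟨hj, hk, hk2, Or.inr ⟨hj2, hjk⟩⟩)
          · rw [commutatorElement_self]; exact one_mem _
          · refine commutatorElement_mem_comm (hS k j (mem_basisPairs.2
              ⟨not_lt.1 hka, hab.trans hj, hj2, Or.inr ⟨hk2, hjk⟩⟩))
        · exact commutatorElement_mem_comm (hDU (hD₂ (Subgroup.commutator_mem_commutator
            (gammaSubgroup_antitone (not_lt.1 hka) (h.mem_gamma k))
            (gammaSubgroup_antitone (not_lt.1 hj2) (h.mem_gamma j)))))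
    · exact hDU (hD₂ (Subgroup.commutator_mem_commutator
        (gammaSubgroup_antitone hj (h.mem_gamma j))
        (gammaSubgroup_antitone (not_lt.1 hk2) (h.mem_gamma k))))
  -- From `b ≤ a` and `a + n ≤ 2b` follows `n ≤ b`, so `⁅x, y'⁆ ∈ γ_{a+b} ≤ γ_{a+n}`.
  have hright : ∀ x ∈ gammaSubgroup (FreeGroup (Fin m)) a,
      ∀ y ∈ gammaSubgroup (FreeGroup (Fin m)) b, ∀ y' ∈ gammaSubgroup (FreeGroup (Fin m)) b,
      ⁅y, ⁅x, y'⁆⁆ ∈ D := fun x hx y hy y' hy' =>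
    commutatorElement_mem_comm (hD₁ (Subgroup.commutator_mem_commutator
      (gammaSubgroup_antitone (by omega) (commutatorElement_mem_gammaSubgroup hx hy')) hy))
  have hleft : ∀ y ∈ gammaSubgroup (FreeGroup (Fin m)) b,
      ∀ x ∈ gammaSubgroup (FreeGroup (Fin m)) a, ∀ x' ∈ gammaSubgroup (FreeGroup (Fin m)) a,
      ⁅x, ⁅y, x'⁆⁆ ∈ D := fun y hy x hx x' hx' =>
    hD₂ (Subgroup.commutator_mem_commutator hx
      (gammaSubgroup_antitone (by omega) (commutatorElement_mem_gammaSubgroup hy hx')))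
  have hzj : ∀ j, a ≤ w j → ∀ y ∈ gammaSubgroup (FreeGroup (Fin m)) b, ⁅z j, y⁆ ∈ U := by
    intro j hj y hy
    have hzj := gammaSubgroup_antitone hj (h.mem_gamma j)
    refine mem_of_le_commutatorSlice (hDU := hDU) (h := hright _ hzj)
      (h.gammaSubgroup_le (by omega) (fun k hk => ?_) fun y hy => ?_) hy
    · exact ⟨gammaSubgroup_antitone hk (h.mem_gamma k), hpair j k hj hk⟩
    · exact ⟨gammaSubgroup_antitone (by omega) hy, hDU (hD₂
        (Subgroup.commutator_mem_commutator hzj (gammaSubgroup_antitone (by omega) hy)))⟩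
  rw [Subgroup.commutator_le]
  intro x hx y hy
  refine commutatorElement_mem_comm (mem_of_le_commutatorSlice (hDU := hDU) (h := hleft y hy)
    (h.gammaSubgroup_le (by omega) (fun j hj => ?_) fun x hx => ?_) hx)
  · exact ⟨gammaSubgroup_antitone hj (h.mem_gamma j), commutatorElement_mem_comm (hzj j hj y hy)⟩
  · exact ⟨gammaSubgroup_antitone (by omega) hx, commutatorElement_mem_comm (hDU (hD₁
      (Subgroup.commutator_mem_commutator hx hy)))⟩

/-- The pairings `l j k` for `(j, k)` in `basisPairs`, restricted to `V ≤ γ_{a+n}`, kill `D` and are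
dual to the generators `⁅z_j, z_k⁆`. -/
theorem HasElimination.nonempty_mulEquiv
    (h : HasElimination (a + n) (freeGenerators m) z w) (hab : b ≤ a) (hb : a + n ≤ 2 * b)
    {V D : Subgroup (FreeGroup (Fin m))} [D.Normal]
    (hV : V = ⁅gammaSubgroup (FreeGroup (Fin m)) a, gammaSubgroup (FreeGroup (Fin m)) b⁆)
    (hD : D = ⁅gammaSubgroup (FreeGroup (Fin m)) (a + n), gammaSubgroup (FreeGroup (Fin m)) b⁆ ⊔
      ⁅gammaSubgroup (FreeGroup (Fin m)) a, gammaSubgroup (FreeGroup (Fin m)) (b + n)⁆) :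
    Nonempty (V ⧸ D.subgroupOf V ≃*
      Multiplicative (Fin (basisPairs w a b n).card → ℤ)) := by
  have hD₁ : ⁅gammaSubgroup (FreeGroup (Fin m)) (a + n), gammaSubgroup (FreeGroup (Fin m)) b⁆ ≤ D :=
    hD ▸ le_sup_left
  have hD₂ : ⁅gammaSubgroup (FreeGroup (Fin m)) a, gammaSubgroup (FreeGroup (Fin m)) (b + n)⁆ ≤ D :=
    hD ▸ le_sup_right
  have hVle : V ≤ gammaSubgroup (FreeGroup (Fin m)) (a + b) :=
    hV ▸ commutator_gammaSubgroup_le a b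
  have hVN : V ≤ gammaSubgroup (FreeGroup (Fin m)) (a + n) :=
    hVle.trans (gammaSubgroup_antitone (by omega))
  have hbN : b ≤ a + n := by omega
  have hDV : D ≤ V := by
    rw [hD, hV]
    exact sup_le (Subgroup.commutator_mono (gammaSubgroup_antitone (by omega)) le_rfl)
      (Subgroup.commutator_mono le_rfl (gammaSubgroup_antitone (by omega)))
  have hcV : ∀ p : basisPairs w a b n, ⁅z p.1.1, z p.1.2⁆ ∈ V := fun p => by
    have := mem_basisPairs.1 p.2
    rw [hV]
    exact Subgroup.commutator_mem_commutator (gammaSubgroup_antitone this.1 (h.mem_gamma _))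
      (gammaSubgroup_antitone this.2.1 (h.mem_gamma _))
  choose l hl using h.exists_pairing hb hbN
  let L : V →* Multiplicative (basisPairs w a b n → ℤ) := MonoidHom.mk'
    (fun v => Multiplicative.ofAdd fun p =>
      (l p.1.1 p.1.2 (Subgroup.inclusion hVN v)).toAdd) fun v v' => by
    simp only [map_mul, toAdd_mul]; rfl
  have hL : ∀ x ∈ gammaSubgroup (FreeGroup (Fin m)) a,
      ∀ y ∈ gammaSubgroup (FreeGroup (Fin m)) b, ∀ hxy : ⁅x, y⁆ ∈ V,
      L ⟨⁅x, y⁆, hxy⟩ = Multiplicative.ofAdd fun p =>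
        h.coord x p.1.1 * h.coord y p.1.2 - h.coord y p.1.1 * h.coord x p.1.2 := by
    intro x hx y hy hxy
    refine congrArg Multiplicative.ofAdd (funext fun p => ?_)
    exact congrArg Multiplicative.toAdd (hl p.1.1 p.1.2 x (gammaSubgroup_antitone hab hx) y hy _)
  have hkill : D.subgroupOf V ≤ L.ker := by
    have hD' : D ≤ L.ker.map V.subtype := by
      rw [hD]
      refine sup_le (Subgroup.commutator_le.2 fun x hx y hy => ?_)
        (Subgroup.commutator_le.2 fun x hx y hy => ?_)
      · have hxy := hDV (hD₁ (Subgroup.commutator_mem_commutator hx hy))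
        refine ⟨⟨_, hxy⟩, ?_, rfl⟩
        rw [SetLike.mem_coe, MonoidHom.mem_ker, hL x (gammaSubgroup_antitone (by omega) hx) y hy]
        refine congrArg Multiplicative.ofAdd (funext fun p => ?_)
        have hx0 : ∀ i, h.coord x i = 0 := fun i => h.coord_eq_zero le_rfl hx (h.weight_lt i)
        rw [hx0, hx0, zero_mul, mul_zero, sub_zero]; rfl
      · have hxy := hDV (hD₂ (Subgroup.commutator_mem_commutator hx hy))
        refine ⟨⟨_, hxy⟩, ?_, rfl⟩
        rw [SetLike.mem_coe, MonoidHom.mem_ker, hL x hx y (gammaSubgroup_antitone (by omega) hy)]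
        refine congrArg Multiplicative.ofAdd (funext fun p => ?_)
        obtain ⟨-, -, h3, h4⟩ := mem_basisPairs.1 p.2
        -- Here `y ∈ γ_{b+n}` kills the first product. The second dies because `x ∈ γ_a` has no
        -- coordinate of weight below `a`, or because `y` has none of weight below `b + n`.
        rw [h.coord_eq_zero (by omega) hy h3, mul_zero, zero_sub]
        rcases h4 with h4 | h4
        · rw [h.coord_eq_zero (by omega) hx h4, mul_zero, neg_zero]; rfl
        · rw [h.coord_eq_zero (by omega) hy h4.1, zero_mul, neg_zero]; rfl
    intro v hv
    obtain ⟨v', hv', he⟩ := hD' (Subgroup.mem_subgroupOf.1 hv)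
    rwa [← Subtype.ext he]
  have hcomm : ∀ x y : V ⧸ D.subgroupOf V, x * y = y * x := by
    intro x y
    obtain ⟨x, rfl⟩ := QuotientGroup.mk_surjective x
    obtain ⟨y, rfl⟩ := QuotientGroup.mk_surjective y
    rw [← commutatorElement_eq_one_iff_mul_comm]
    refine (QuotientGroup.eq_one_iff (⁅x, y⁆ : V)).2 (Subgroup.mem_subgroupOf.2 ?_)
    exact hD₁ (Subgroup.commutator_mem_commutator (hVN x.2)
      (gammaSubgroup_antitone (by omega) (hVle y.2)))
  have hclosure : Subgroup.closure (Set.range fun p : basisPairs w a b n =>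
      ((⟨⁅z p.1.1, z p.1.2⁆, hcV p⟩ : V) : V ⧸ D.subgroupOf V)) = ⊤ := by
    rw [eq_top_iff]
    intro x _
    obtain ⟨x, rfl⟩ := QuotientGroup.mk_surjective x
    set T := Subgroup.closure (Set.range fun p : basisPairs w a b n =>
      ((⟨⁅z p.1.1, z p.1.2⁆, hcV p⟩ : V) : V ⧸ D.subgroupOf V)) with hT
    have hle : Subgroup.closure (Set.range fun p : basisPairs w a b n => ⁅z p.1.1, z p.1.2⁆) ⊔ D ≤
        (T.comap (QuotientGroup.mk' (D.subgroupOf V))).map V.subtype := by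
      refine sup_le ((Subgroup.closure_le _).2 ?_) fun d hd => ?_
      · rintro _ ⟨p, rfl⟩
        exact ⟨⟨_, hcV p⟩, Subgroup.subset_closure ⟨p, rfl⟩, rfl⟩
      · refine ⟨⟨d, hDV hd⟩, ?_, rfl⟩
        change ((⟨d, hDV hd⟩ : V) : V ⧸ D.subgroupOf V) ∈ T
        rw [(QuotientGroup.eq_one_iff _).2 (Subgroup.mem_subgroupOf.2 hd)]
        exact one_mem T
    obtain ⟨x', hx', he⟩ := hle (h.commutator_le_closure_sup hab hb hD₁ hD₂ (hV.le x.2))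
    obtain rfl : x' = x := Subtype.ext he
    exact hx'
  have key := nonempty_mulEquiv_of_dual hcomm (fun p : basisPairs w a b n =>
    ((⟨⁅z p.1.1, z p.1.2⁆, hcV p⟩ : V) : V ⧸ D.subgroupOf V)) hclosure
    (QuotientGroup.lift _ L hkill) fun p => by
      obtain ⟨h1, h2, -, h4⟩ := mem_basisPairs.1 p.2
      refine (QuotientGroup.lift_mk' _ _ _).trans ?_
      rw [hL _ (gammaSubgroup_antitone h1 (h.mem_gamma _)) _
        (gammaSubgroup_antitone h2 (h.mem_gamma _)), h.coord_apply hb hbN (hab.trans h1),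
        h.coord_apply hb hbN h2]
      refine congrArg Multiplicative.ofAdd (funext fun q => ?_)
      obtain ⟨k1, -, -, k4⟩ := mem_basisPairs.1 q.2
      -- No pair in `basisPairs` is the reversal of another or of itself, so the antisymmetric term
      -- of the pairing contributes nothing.
      have hswap : ¬(q.1.1 = p.1.2 ∧ q.1.2 = p.1.1) := by
        rintro ⟨e1, e2⟩
        rw [e1, e2] at k4
        rw [e1] at k1
        rcases h4 with h4 | h4
        · omega
        · rcases k4 with k4 | k4
          · omega
          · exact lt_asymm h4.2 k4.2
      have hprod : (Pi.single p.1.2 1 : Fin r → ℤ) q.1.1 * (Pi.single p.1.1 1 : Fin r → ℤ) q.1.2 =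
          0 := by
        by_cases e1 : q.1.1 = p.1.2
        · rw [Pi.single_eq_of_ne (i := p.1.1) fun e2 => hswap ⟨e1, e2⟩, mul_zero]
        · rw [Pi.single_eq_of_ne e1, zero_mul]
      rw [hprod, sub_zero]
      by_cases hqp : q = p
      · subst hqp; simp
      · rw [Pi.single_eq_of_ne hqp]
        by_cases e1 : q.1.1 = p.1.1
        · rw [Pi.single_eq_of_ne (i := p.1.2) fun e2 => hqp (Subtype.ext (Prod.ext e1 e2)),
            mul_zero]
        · rw [Pi.single_eq_of_ne e1, zero_mul]
  rwa [Fintype.card_coe] at key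

end Structure

/-! ### Independence of the free presentation. -/

section BaerInvariance

theorem exists_wordValue_congr (v : FreeGroup ℕ) : ∃ k : ℕ, ∀ {G : Type*} [Group G]
    (f f' : ℕ → G), (∀ j < k, f j = f' j) → wordValue v f = wordValue v f' := by
  induction v using FreeGroup.induction_on with
  | C1 => exact ⟨0, fun f f' _ => by simp [wordValue]⟩
  | of x => exact ⟨x + 1, fun f f' h => by simpa [wordValue] using h x x.lt_succ_self⟩
  | inv_of x ih =>
    obtain ⟨k, hk⟩ := ih
    exact ⟨k, fun f f' h => by
      have := hk f f' h
      simp only [wordValue, map_inv] at this ⊢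
      rw [this]⟩
  | mul x y hx hy =>
    obtain ⟨k, hk⟩ := hx
    obtain ⟨l, hl⟩ := hy
    exact ⟨max k l, fun f f' h => by
      have h1 := hk f f' fun j hj => h j (lt_max_of_lt_left hj)
      have h2 := hl f f' fun j hj => h j (lt_max_of_lt_right hj)
      simp only [wordValue, map_mul] at h1 h2 ⊢
      rw [h1, h2]⟩

variable {V : Set (FreeGroup ℕ)}

/-- The generators of `[R V* F]` allow one argument to change at a time; a word involves finitely
many variables, so finitely many changes suffice. -/
theorem mk_wordValue_eq {F : Type*} [Group F] {R : Subgroup F} [R.Normal] {v : FreeGroup ℕ}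
    (hv : v ∈ V) {f f' : ℕ → F} (h : ∀ j, (f j)⁻¹ * f' j ∈ R) :
    ((wordValue v f : F) : F ⧸ starSubgroup V R) = (wordValue v f' : F) := by
  have step : ∀ k : ℕ, ((wordValue v f : F) : F ⧸ starSubgroup V R) =
      (wordValue v fun j => if j < k then f' j else f j : F) := by
    intro k
    induction k with
    | zero => simp
    | succ k ih =>
      rw [ih, eq_comm, ← div_eq_one, ← QuotientGroup.mk_div, QuotientGroup.eq_one_iff,
        div_eq_mul_inv]
      refine Subgroup.subset_closure ⟨v, hv, fun j => if j < k then f' j else f j, k, _, h k, ?_⟩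
      congr 2
      funext j
      rcases lt_trichotomy j k with hj | rfl | hj
      · rw [Function.update_of_ne hj.ne, if_pos hj, if_pos (by omega)]
      · simp
      · rw [Function.update_of_ne hj.ne', if_neg (by omega), if_neg (by omega)]
  obtain ⟨k, hk⟩ := exists_wordValue_congr v
  rw [step k, hk _ f' fun j hj => if_pos hj]

variable {F₁ F₂ G : Type*} [Group F₁] [Group F₂] [Group G] {π₁ : F₁ →* G} {π₂ : F₂ →* G}

theorem verbalSubgroup_le_comap (V : Set (FreeGroup ℕ)) (φ : F₁ →* F₂) :
    verbalSubgroup V F₁ ≤ (verbalSubgroup V F₂).comap φ := by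
  refine (Subgroup.closure_le _).2 ?_
  rintro _ ⟨v, hv, f, rfl⟩
  exact Subgroup.subset_closure ⟨v, hv, _, map_wordValue φ v f⟩

theorem starSubgroup_le_comap (V : Set (FreeGroup ℕ)) {φ : F₁ →* F₂} (hφ : π₂.comp φ = π₁) :
    starSubgroup V π₁.ker ≤ (starSubgroup V π₂.ker).comap φ := by
  refine (Subgroup.closure_le _).2 ?_
  rintro _ ⟨v, hv, f, i, r, hr, rfl⟩
  refine Subgroup.subset_closure ⟨v, hv, fun j => φ (f j), i, φ r, ?_, ?_⟩
  · rw [MonoidHom.mem_ker] at hr ⊢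
    rw [← hr, ← hφ]; rfl
  · rw [map_mul, map_inv, map_wordValue, map_wordValue]
    congr 2
    funext j
    by_cases hj : j = i
    · subst hj; simp
    · simp [hj]

/-- Two lifts of the same homomorphism agree on the verbal subgroup modulo `[R V* F]`. -/
theorem mk_map_eq_of_mem_verbalSubgroup {φ ψ : F₁ →* F₂} (h : π₂.comp φ = π₂.comp ψ) {x : F₁}
    (hx : x ∈ verbalSubgroup V F₁) :
    (φ x : F₂ ⧸ starSubgroup V π₂.ker) = ψ x := by
  let q := QuotientGroup.mk' (starSubgroup V π₂.ker)
  have : verbalSubgroup V F₁ ≤ (q.comp φ).eqLocus (q.comp ψ) := by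
    refine (Subgroup.closure_le _).2 ?_
    rintro _ ⟨v, hv, f, rfl⟩
    change ((φ (wordValue v f) : F₂) : F₂ ⧸ starSubgroup V π₂.ker) = ψ (wordValue v f)
    rw [map_wordValue, map_wordValue]
    refine mk_wordValue_eq (R := π₂.ker) hv fun j => ?_
    rw [MonoidHom.mem_ker, map_mul, map_inv, inv_mul_eq_one]
    exact DFunLike.congr_fun h (f j)
  exact this hx

/-- The homomorphism of Baer invariants induced by a homomorphism of presentations. -/
def baerMap (V : Set (FreeGroup ℕ)) (φ : F₁ →* F₂) (hφ : π₂.comp φ = π₁) :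
    BaerInvariant V π₁ →* BaerInvariant V π₂ :=
  QuotientGroup.map _ _
    ((φ.comp (π₁.ker ⊓ verbalSubgroup V F₁).subtype).codRestrict
      (π₂.ker ⊓ verbalSubgroup V F₂) fun x =>
        ⟨by
          have h : π₁ x = 1 := x.2.1
          exact (DFunLike.congr_fun hφ (x : F₁)).trans h, verbalSubgroup_le_comap V φ x.2.2⟩)
    fun x hx => starSubgroup_le_comap V hφ hx

/-- The composite `ψ ∘ φ` and the identity lift the same map to `G`, hence agree on the verbal
subgroup modulo `[R V* F]`. -/
theorem baerMap_comp_apply {φ : F₁ →* F₂} (hφ : π₂.comp φ = π₁) {ψ : F₂ →* F₁}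
    (hψ : π₁.comp ψ = π₂) (x : BaerInvariant V π₁) :
    baerMap V ψ hψ (baerMap V φ hφ x) = x := by
  obtain ⟨x, rfl⟩ := QuotientGroup.mk_surjective x
  refine QuotientGroup.eq.2 (Subgroup.mem_subgroupOf.2 ?_)
  have h : π₁.comp (ψ.comp φ) = π₁.comp (MonoidHom.id F₁) := by
    rw [← MonoidHom.comp_assoc, hψ, hφ, MonoidHom.comp_id]
  exact QuotientGroup.eq.1 (mk_map_eq_of_mem_verbalSubgroup h x.2.2)

theorem exists_lift_of_isFreeGroup [IsFreeGroup F₁] (π₁ : F₁ →* G)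
    (h₂ : Function.Surjective π₂) : ∃ φ : F₁ →* F₂, π₂.comp φ = π₁ := by
  choose s hs using h₂
  exact ⟨IsFreeGroup.lift fun x => s (π₁ (IsFreeGroup.of x)),
    IsFreeGroup.ext_hom fun x => by simp [hs]⟩

/-- The Baer invariant does not depend on the free presentation. -/
theorem nonempty_baerInvariant_mulEquiv [IsFreeGroup F₁] [IsFreeGroup F₂] (V : Set (FreeGroup ℕ))
    (h₁ : Function.Surjective π₁) (h₂ : Function.Surjective π₂) :
    Nonempty (BaerInvariant V π₁ ≃* BaerInvariant V π₂) := by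
  obtain ⟨φ, hφ⟩ := exists_lift_of_isFreeGroup π₁ h₂
  obtain ⟨ψ, hψ⟩ := exists_lift_of_isFreeGroup π₂ h₁
  exact ⟨{ baerMap V φ hφ with
    invFun := baerMap V ψ hψ
    left_inv := baerMap_comp_apply hφ hψ
    right_inv := baerMap_comp_apply hψ hφ }⟩

end BaerInvariance

/-! ### The nilpotent product as a free nilpotent group. -/

section NilpotentProduct

theorem gammaSubgroup_le_comap {G H : Type*} [Group G] [Group H] (φ : G →* H) (k : ℕ) :
    gammaSubgroup G k ≤ (gammaSubgroup H k).comap φ := by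
  induction k with
  | zero => exact fun _ _ => trivial
  | succ k ih =>
    rcases Nat.eq_zero_or_pos k with rfl | hk
    · exact fun _ _ => trivial
    · rw [gammaSubgroup_succ hk, gammaSubgroup_succ hk, ← Subgroup.map_le_iff_le_comap,
        Subgroup.map_commutator]
      exact Subgroup.commutator_mono (Subgroup.map_le_iff_le_comap.2 ih) le_top

/-- The free product of infinite cyclic groups is a free group. -/
def freeGroupEquivCoprodInt (ι : Type*) :
    FreeGroup ι ≃* Monoid.CoprodI fun _ : ι => Multiplicative ℤ :=
  MonoidHom.toMulEquiv
    (FreeGroup.lift fun i => Monoid.CoprodI.of (i := i) (Multiplicative.ofAdd (1 : ℤ)))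
    (Monoid.CoprodI.lift fun i => zpowersHom _ (FreeGroup.of i))
    (by ext i; simp)
    (by
      ext i
      simp)

variable {n m : ℕ}

/-- As `n ≥ 1`, it is enough to treat `γ₂`. Generators of different factors commute modulo the
cartesian subgroup, and each factor has a single generator. -/
theorem gammaSubgroup_le_cartesianSubgroup (hn : 1 ≤ n) :
    gammaSubgroup (Monoid.CoprodI fun _ : Fin m => Multiplicative ℤ) (n + 1) ≤
      cartesianSubgroup fun _ : Fin m => Multiplicative ℤ := by
  refine (gammaSubgroup_antitone (show 2 ≤ n + 1 by omega)).trans ?_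
  rw [gammaSubgroup_succ le_rfl, gammaSubgroup_one]
  have htop : (⊤ : Subgroup (Monoid.CoprodI fun _ : Fin m => Multiplicative ℤ)) =
      Subgroup.closure (Set.range fun i : Fin m => freeGroupEquivCoprodInt (Fin m)
        (FreeGroup.of i)) := by
    have := MonoidHom.map_closure (freeGroupEquivCoprodInt (Fin m)).toMonoidHom
      (Set.range FreeGroup.of)
    rw [FreeGroup.closure_range_of, ← Set.range_comp] at this
    rw [← Subgroup.map_top_of_surjective (freeGroupEquivCoprodInt (Fin m)).toMonoidHom
      (freeGroupEquivCoprodInt (Fin m)).surjective]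
    exact this
  rw [htop]
  refine commutator_closure_le ?_
  rintro _ ⟨i, rfl⟩ _ ⟨j, rfl⟩
  by_cases hij : i = j
  · subst hij
    rw [commutatorElement_self]
    exact one_mem _
  · exact Subgroup.subset_normalClosure ⟨i, j, hij, Multiplicative.ofAdd 1,
      Multiplicative.ofAdd 1, by simp [freeGroupEquivCoprodInt]⟩

/-- The nilpotent product of infinite cyclic groups is a free nilpotent group. -/
theorem exists_presentation_nilpotentProduct (hn : 1 ≤ n) :
    ∃ π : FreeGroup (Fin m) →* NilpotentProduct n (fun _ : Fin m => Multiplicative ℤ),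
      Function.Surjective π ∧ π.ker = gammaSubgroup (FreeGroup (Fin m)) (n + 1) := by
  refine ⟨(QuotientGroup.mk' _).comp (freeGroupEquivCoprodInt (Fin m)).toMonoidHom,
    (QuotientGroup.mk'_surjective _).comp (freeGroupEquivCoprodInt (Fin m)).surjective, ?_⟩
  rw [← MonoidHom.comap_ker, QuotientGroup.ker_mk', verbalSubgroup_gammaWord,
    inf_eq_left.2 (gammaSubgroup_le_cartesianSubgroup hn)]
  refine le_antisymm (fun x hx => ?_) (gammaSubgroup_le_comap _ _)
  have := gammaSubgroup_le_comap (freeGroupEquivCoprodInt (Fin m)).symm.toMonoidHom _ hx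
  simpa using this

end NilpotentProduct

/-! ### The rank in terms of Witt numbers. -/

section Counting

variable {m N r : ℕ} {z : Fin r → FreeGroup (Fin m)} {w : Fin r → ℕ}

theorem HasElimination.card_weight_mem_Ico (h : HasElimination N (freeGenerators m) z w)
    {lo hi : ℕ} (hlo : 1 ≤ lo) (hhi : hi ≤ N) :
    ((Finset.univ.filter fun j => lo ≤ w j ∧ w j < hi).card : ℚ) =
      ∑ i ∈ Finset.Ico lo hi, wittNumber i m := by
  rw [Finset.card_eq_sum_card_fiberwise (f := w) (t := Finset.Ico lo hi)
    (fun j hj => by simpa using hj), Nat.cast_sum]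
  refine Finset.sum_congr rfl fun i hi' => ?_
  rw [Finset.mem_Ico] at hi'
  rw [← card_weight_eq_wittNumber h.weight_pos h.X_pow_dvd (by omega : 1 ≤ i) (by omega),
    Finset.filter_filter]
  congr 2
  ext j
  simp only [Finset.mem_filter, Finset.mem_univ, true_and, and_iff_right_iff_imp]
  rintro rfl
  exact hi'

theorem wittNumber_two (d : ℚ) : wittNumber 2 d = (d * d - d) / 2 := by
  rw [wittNumber, Nat.Prime.divisors Nat.prime_two, Finset.sum_pair (by norm_num),
    ArithmeticFunction.moebius_apply_prime Nat.prime_two]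
  simp
  ring

theorem card_filter_lt_eq_wittNumber {α : Type*} [LinearOrder α] (s : Finset α) :
    (((s ×ˢ s).filter fun p => p.1 < p.2).card : ℚ) = wittNumber 2 s.card := by
  have hswap : ((s ×ˢ s).filter fun p => p.2 < p.1).card =
      ((s ×ˢ s).filter fun p => p.1 < p.2).card := by
    refine Finset.card_bij (fun p _ => p.swap) (fun p hp => ?_) (fun p _ q _ h => ?_)
      fun p hp => ⟨p.swap, ?_, Prod.swap_swap p⟩
    · simp only [Finset.mem_filter, Finset.mem_product, Prod.fst_swap, Prod.snd_swap] at hp ⊢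
      tauto
    · exact Prod.swap_injective h
    · simp only [Finset.mem_filter, Finset.mem_product, Prod.fst_swap, Prod.snd_swap] at hp ⊢
      tauto
  have hsplit : s.offDiag = ((s ×ˢ s).filter fun p => p.1 < p.2) ∪
      ((s ×ˢ s).filter fun p => p.2 < p.1) := by
    ext p
    simp only [Finset.mem_offDiag, Finset.mem_union, Finset.mem_filter, Finset.mem_product,
      ne_iff_lt_or_gt]
    tauto
  have hdisj : Disjoint ((s ×ˢ s).filter fun p => p.1 < p.2)
      ((s ×ˢ s).filter fun p => p.2 < p.1) := by
    rw [Finset.disjoint_filter]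
    exact fun p _ h => h.not_gt
  have hcard := s.offDiag_card
  rw [hsplit, Finset.card_union_of_disjoint hdisj, hswap] at hcard
  have hcast := congrArg (Nat.cast : ℕ → ℚ) hcard
  rw [Nat.cast_sub (Nat.le_mul_self _)] at hcast
  push_cast at hcast
  rw [wittNumber_two]
  linarith

/-- Here `w p.2 < b + n ≤ a` always holds, so `basisPairs` is a full product. -/
theorem HasElimination.card_basisPairs_of_le {a b n : ℕ}
    (h : HasElimination (a + n) (freeGenerators m) z w) (hb : 1 ≤ b) (hab : b ≤ a)
    (hba : b + n ≤ a) : ((basisPairs w a b n).card : ℚ) =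
      (∑ i ∈ Finset.Ico a (a + n), wittNumber i m) *
        ∑ i ∈ Finset.Ico b (b + n), wittNumber i m := by
  rw [← h.card_weight_mem_Ico (by omega) le_rfl, ← h.card_weight_mem_Ico hb (by omega),
    ← Nat.cast_mul, ← Finset.card_product]
  congr 2
  ext p
  have := h.weight_lt p.1
  simp only [mem_basisPairs, Finset.mem_product, Finset.mem_filter, Finset.mem_univ, true_and]
  constructor
  · rintro ⟨h1, h2, h3, -⟩
    exact ⟨⟨h1, this⟩, h2, h3⟩
  · rintro ⟨⟨h1, -⟩, h2, h3⟩
    exact ⟨h1, h2, h3, Or.inl (by omega)⟩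

/-- Split by whether `w p.2 < a`: the first part is a product, the second consists of the increasing
pairs of indices with weights in `[a, b + n)`, counted by `χ₂`. -/
theorem HasElimination.card_basisPairs_of_ge {a b n : ℕ}
    (h : HasElimination (a + n) (freeGenerators m) z w) (hb : 1 ≤ b) (hab : b ≤ a)
    (hba : a ≤ b + n) : ((basisPairs w a b n).card : ℚ) =
      (∑ i ∈ Finset.Ico a (a + n), wittNumber i m) * (∑ i ∈ Finset.Ico b a, wittNumber i m) +
        wittNumber 2 (∑ i ∈ Finset.Ico a (b + n), wittNumber i m) := by
  rw [← h.card_weight_mem_Ico (by omega) le_rfl, ← h.card_weight_mem_Ico hb (by omega),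
    ← h.card_weight_mem_Ico (by omega) (show b + n ≤ a + n by omega),
    ← card_filter_lt_eq_wittNumber, ← Nat.cast_mul, ← Finset.card_product, ← Nat.cast_add,
    ← Finset.card_union_of_disjoint]
  · congr 2
    ext p
    have := h.weight_lt p.1
    simp only [mem_basisPairs, Finset.mem_product, Finset.mem_filter, Finset.mem_univ, true_and,
      Finset.mem_union]
    constructor
    · rintro ⟨h1, h2, h3, h4 | ⟨h4, h5⟩⟩
      · exact Or.inl ⟨⟨h1, this⟩, h2, h4⟩
      · by_cases h6 : w p.2 < a
        · exact Or.inl ⟨⟨h1, this⟩, h2, h6⟩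
        · exact Or.inr ⟨⟨⟨h1, h4⟩, not_lt.1 h6, h3⟩, h5⟩
    · rintro (⟨⟨h1, -⟩, h2, h3⟩ | ⟨⟨⟨h1, h2⟩, h3, h4⟩, h5⟩)
      · exact ⟨h1, h2, by omega, Or.inl h3⟩
      · exact ⟨h1, by omega, h4, Or.inr ⟨h2, h5⟩⟩
  · rw [Finset.disjoint_left]
    intro p hp hp'
    simp only [Finset.mem_product, Finset.mem_filter, Finset.mem_univ, true_and] at hp hp'
    omega

end Counting

/-! ### The main theorem. -/

theorem corollary2p9 (n m c₁ c₂ : ℕ) (hn : 1 ≤ n) (hc : c₂ ≤ c₁)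
    (hnc : 2 * (n : ℤ) - 2 < 2 * (c₂ : ℤ) - (c₁ : ℤ))
    {F : Type*} [Group F] [IsFreeGroup F]
    (π : F →* NilpotentProduct n (fun _ : Fin m => Multiplicative ℤ))
    (hπ : Function.Surjective π) :
    (c₂ + n < c₁ + 1 →
      ∃ k : ℕ,
        (k : ℚ) = (∑ i ∈ Finset.Icc (c₁ + 1) (c₁ + n), wittNumber i m) *
            (∑ i ∈ Finset.Icc (c₂ + 1) (c₂ + n), wittNumber i m) ∧
        Nonempty (BaerInvariant {outerCommutatorWord c₁ c₂} π ≃* Multiplicative (Fin k → ℤ))) ∧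
    (c₁ + 1 ≤ c₂ + n →
      ∃ k' : ℕ,
        (k' : ℚ) = (∑ i ∈ Finset.Icc (c₁ + 1) (c₁ + n), wittNumber i m) *
            (∑ i ∈ Finset.Icc (c₂ + 1) c₁, wittNumber i m) +
          wittNumber 2 (∑ i ∈ Finset.Icc (c₁ + 1) (c₂ + n), wittNumber i m) ∧
        Nonempty (BaerInvariant {outerCommutatorWord c₁ c₂} π ≃*
          Multiplicative (Fin k' → ℤ))) := by
  obtain ⟨π', hπ', hker⟩ := exists_presentation_nilpotentProduct (m := m) hn
  obtain ⟨e⟩ := nonempty_baerInvariant_mulEquiv {outerCommutatorWord c₁ c₂} hπ hπ'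
  obtain ⟨r, z, w, h⟩ := exists_hasElimination_freeGenerators m (show 1 ≤ c₁ + 1 + n by omega)
  have hV : π'.ker ⊓ verbalSubgroup {outerCommutatorWord c₁ c₂} (FreeGroup (Fin m)) =
      ⁅gammaSubgroup (FreeGroup (Fin m)) (c₁ + 1), gammaSubgroup (FreeGroup (Fin m)) (c₂ + 1)⁆ := by
    rw [hker, verbalSubgroup_outerCommutatorWord, inf_eq_right]
    exact (commutator_gammaSubgroup_le _ _).trans (gammaSubgroup_antitone (by omega))
  have hD : starSubgroup {outerCommutatorWord c₁ c₂} π'.ker =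
      ⁅gammaSubgroup (FreeGroup (Fin m)) (c₁ + 1 + n), gammaSubgroup (FreeGroup (Fin m)) (c₂ + 1)⁆ ⊔
      ⁅gammaSubgroup (FreeGroup (Fin m)) (c₁ + 1),
        gammaSubgroup (FreeGroup (Fin m)) (c₂ + 1 + n)⁆ := by
    rw [hker, starSubgroup_outerCommutatorWord, show n + 1 + c₁ = c₁ + 1 + n by omega,
      show n + 1 + c₂ = c₂ + 1 + n by omega]
  -- Here `2c₂ - c₁ ≥ 2n - 1` and `n ≥ 1` give `(c₁ + 1) + n ≤ 2(c₂ + 1)`.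
  obtain ⟨e'⟩ := h.nonempty_mulEquiv (a := c₁ + 1) (b := c₂ + 1) (by omega) (by omega) hV hD
  have hIcc : ∀ x y : ℕ, Finset.Icc x y = Finset.Ico x (y + 1) := fun x y => by
    ext i; simp only [Finset.mem_Icc, Finset.mem_Ico]; omega
  have hshift : ∀ c : ℕ, c + n + 1 = c + 1 + n := fun c => by omega
  refine ⟨fun hlt => ⟨_, ?_, ⟨e.trans e'⟩⟩, fun hle => ⟨_, ?_, ⟨e.trans e'⟩⟩⟩
  · rw [hIcc, hIcc, hshift, hshift]
    exact h.card_basisPairs_of_le (by omega) (by omega) (by omega)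
  · rw [hIcc, hIcc, hIcc, hshift, hshift]
    exact h.card_basisPairs_of_ge (by omega) (by omega) (by omega)
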